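/- Let $(R,\mathfrak m,k)$ be a one-dimensional Cohen--Macaulay (Noetherian, commutative) local ring and let $M$ be a finitely generated torsion-free $R$-module such that $M\otimes_R M^{*}$ is torsion-free, where $M^{*}=\operatorname{Hom}_R(M,R)$. Conventions. A module $X$ is torsion-free if every non-zerodivisor of $R$ acts injectively on it. $M$ has rank if there is an integer $r\ge 0$ with $M_{\mathfrak p}\cong R_{\mathfrak p}^{\oplus r}$ for all $\mathfrak p\in\operatorname{Ass}(R)$. For a finitely generated module $X\neq 0$ of dimension $d$, $\mathrm e_R(X)=d!\,\lim_{n\to\infty}\ell_R(X/\mathfrak m^nX)/n^{d}$; put $\mathrm e_R(0)=0$ and $\mathrm e(R)=\mathrm e_R(R)$. A finitely generated module $X$ is Ulrich if it is Cohen--Macaulay (that is, $X=0$ or $\operatorname{depth}X=\dim X$) and $\mathrm e_R(X)\le \ell_R(X/\mathfrak mX)$. $R$ has minimal multiplicity if $\mathrm e(R)=\mu_R(\mathfrak m)-\dim R+1$, where $\mu_R(\mathfrak m)$ is the minimal number of generators of $\mathfrak m$. (1) Suppose that $M$ has rank. If $R$ has minimal multiplicity or $M$ is Ulrich, then $M$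 is free. If $M$ is Ulrich and $M\ne 0$, then $R$ is regular. (2) In particular, the Huneke--Wiegand conjecture holds for Ulrich modules: if $R$ is a domain and $M$ is Ulrich (no hypothesis on rank is needed here), then $M$ is free, and $R$ is regular if $M\neq0$. -/

import Mathlib

open scoped TensorProduct

universe u v

namespace UlrichModule

open IsLocalRing

section

variable (R : Type u) [CommRing R] (M : Type v) [AddCommGroup M] [Module R M]

/-- The Krull dimension of (the support of) `M` as a natural number. It is `0` for `M = 0`; for a
finitely generated module over a Noetherian local ring the dimension is finite. -/
noncomputable def dim : ℕ := ((Module.supportDim R M).unbotD 0).toNat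

/-- The Hilbert-Samuel multiplicity `e_R(I, M) = d! * lim_n ℓ_R(M / I ^ n M) / n ^ d`,
where `d = dim_R M`. The lengths and the limit are finite whenever `R` is Noetherian local, `M` is
finitely generated and `I` is primary to the maximal ideal. For `M = 0` the value is `0`. -/
noncomputable def multiplicity {R : Type u} [CommRing R] (I : Ideal R)
    (M : Type v) [AddCommGroup M] [Module R M] : ℝ :=
  ((dim R M).factorial : ℝ) *
    Filter.limUnder Filter.atTop (fun n : ℕ =>
      ((Module.length R (M ⧸ (I ^ n • ⊤ : Submodule R M))).toNat : ℝ) / (n : ℝ) ^ dim R M)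

/-- `M` has rank `r` on a set `Y` of primes: `M_p` is free of rank `r` over `R_p` for all
`p ∈ Y`. -/
def HasRankOn (Y : Set (PrimeSpectrum R)) (r : ℕ) : Prop :=
  ∀ p ∈ Y, Nonempty (LocalizedModule p.asIdeal.primeCompl M
    ≃ₗ[Localization.AtPrime p.asIdeal] (Fin r → Localization.AtPrime p.asIdeal))

/-- `M` has rank: for some `r` it has rank `r` on the set of associated primes of `R`. -/
def HasRank : Prop :=
  ∃ r : ℕ, HasRankOn R M {p : PrimeSpectrum R | p.asIdeal ∈ associatedPrimes R R} r

variable [IsLocalRing R]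

/-- The depth of a module over a local ring: the supremum of the lengths of the `M`-regular
sequences contained in the maximal ideal. It is used for `M ≠ 0` only. -/
noncomputable def depth : ℕ∞ :=
  ⨆ rs : {l : List R // (∀ x ∈ l, x ∈ maximalIdeal R) ∧ RingTheory.Sequence.IsRegular M l},
    (rs.1.length : ℕ∞)

/-- Cohen-Macaulay modules over a local ring: `M = 0` or `depth M = dim M`. -/
def IsCohenMacaulay : Prop :=
  Subsingleton M ∨ (depth R M : WithBot ℕ∞) = Module.supportDim R M

variable {R} in
/-- `M` is `c`-Ulrich with respect to `I`: it is Cohen-Macaulay, `M / I M` is free over `R / I`,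
and `e_R(I, M) ≤ c * ℓ_R(M / I M)`. -/
structure IsCUlrichWrt (I : Ideal R) (c : ℝ) : Prop where
  isCohenMacaulay : IsCohenMacaulay R M
  free : Module.Free (R ⧸ I) (M ⧸ (I • ⊤ : Submodule R M))
  multiplicity_le : multiplicity I M ≤
    c * ((Module.length R (M ⧸ (I • ⊤ : Submodule R M))).toNat : ℝ)

/-- `M` is Ulrich: it is `1`-Ulrich with respect to the maximal ideal. -/
def IsUlrich : Prop := IsCUlrichWrt M (maximalIdeal R) 1

/-- `R` has minimal multiplicity: `e(R) = μ(𝔪) - dim R + 1`, where `μ(𝔪)` is the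
minimal number of generators of the maximal ideal. Used for Cohen-Macaulay `R`. -/
def HasMinimalMultiplicity : Prop :=
  multiplicity (maximalIdeal R) R =
    ((maximalIdeal R).spanFinrank : ℝ) - (dim R R : ℝ) + 1

end

end UlrichModule

namespace UlrichModule

open IsLocalRing Polynomial

/-! ### The saturated filtration of a module attached to an ideal. -/

section SaturatedPower

variable {R : Type*} [CommRing R] {N : Type*} [AddCommGroup N] [Module R N]

/-! Write μ for the minimal number of generators and e for the multiplicity of `R`. A torsion-free
`M` of rank r agrees with `R ^ r` up to a non-zero-divisor (`IsQuasiFree`), so it has multiplicity r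
e, and μ(M) ≤ r e. The same bound for the torsion-free module M ⊗ M*, of rank r², reads μ(M) μ(M*) ≤
r² e.

If `M` is Ulrich and nonzero, then μ(M) = r e. Hence μ(M*) ≤ r, so M* is free, and `M` is free
because it is reflexive (`IsQuasiFree.bijective_eval`). A nonzero free Ulrich module forces e = 1,
whence μ(m) ≤ e = 1 and `R` is regular.

Minimal multiplicity means μ(m) = e. Free summands of rank one are split off by induction on r. If
there is none, M* = Hom(M, m) lies in a power of m with torsion-free quotient, and
`le_length_of_torsionFree_quotient` gives μ(M*) = r e; now μ(M) ≤ r and `M` is free.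

The facts on multiplicities classically use a superficial element, which needs an infinite residue
field. Its role is played here by a polynomial x in T whose coefficients generate the ideal. In
place of a localisation of R[T], lengths are counted on polynomials of degree less than p:
multiplication by x costs deg x further coefficients, which is negligible as p grows. The filtration
F_n = `satPow N I n` is within a bounded shift of I^n N when I contains an N-regular element, and x
w ∈ F_{n+1}[T] implies w ∈ F_n[T]. -/

theorem pow_smul_span_le_succ {I : Ideal R} {K n : ℕ} {w : N}
    (h : I ^ K • (R ∙ w) ≤ I ^ (K + n) • (⊤ : Submodule R N)) (j : ℕ) :
    I ^ (K + j) • (R ∙ w) ≤ I ^ (K + j + n) • (⊤ : Submodule R N) := by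
  rw [add_comm K j, pow_add, mul_smul, add_assoc, pow_add I j, mul_smul]
  exact smul_mono_right _ h

variable (N) in
/-- The union over `K` of the colon submodules `(I ^ (K + n) N : I ^ K)`. -/
def satPow (I : Ideal R) (n : ℕ) : Submodule R N where
  carrier := {w | ∃ K : ℕ, I ^ K • (R ∙ w) ≤ I ^ (K + n) • (⊤ : Submodule R N)}
  zero_mem' := ⟨0, by simp⟩
  add_mem' := by
    rintro a b ⟨K, hK⟩ ⟨L, hL⟩
    refine ⟨K + L, ?_⟩
    have h1 := pow_smul_span_le_succ hK L
    have h2 := pow_smul_span_le_succ hL K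
    rw [add_comm L K] at h2
    refine le_trans ?_ (sup_le h1 h2)
    rw [← Submodule.smul_sup]
    refine smul_mono_right _ ?_
    rw [Submodule.span_singleton_le_iff_mem]
    exact Submodule.add_mem_sup (Submodule.mem_span_singleton_self a)
      (Submodule.mem_span_singleton_self b)
  smul_mem' := by
    rintro r a ⟨K, hK⟩
    exact ⟨K, le_trans (smul_mono_right _ (Submodule.span_singleton_smul_le R r a)) hK⟩

variable (I : Ideal R)

theorem pow_smul_top_le_satPow (n : ℕ) : I ^ n • (⊤ : Submodule R N) ≤ satPow N I n :=
  fun w hw => ⟨0, by simpa using hw⟩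

theorem satPow_antitone : Antitone (satPow N I) := by
  refine antitone_nat_of_succ_le fun n w ⟨K, hK⟩ => ⟨K, hK.trans ?_⟩
  exact Submodule.smul_mono_left (Ideal.pow_le_pow_right (by omega))

theorem smul_mem_satPow {n : ℕ} {a : R} (ha : a ∈ I) {w : N} (hw : w ∈ satPow N I n) :
    a • w ∈ satPow N I (n + 1) := by
  obtain ⟨K, hK⟩ := hw
  refine ⟨K, ?_⟩
  have : I ^ K • (R ∙ (a • w)) ≤ I • (I ^ K • (R ∙ w)) := by
    rw [← mul_smul, mul_comm, mul_smul]
    refine smul_mono_right _ ?_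
    rw [Submodule.span_singleton_le_iff_mem]
    exact Submodule.smul_mem_smul ha (Submodule.mem_span_singleton_self w)
  refine this.trans ?_
  rw [← add_assoc, pow_succ', mul_smul]
  exact smul_mono_right _ hK

theorem smul_satPow_le (n : ℕ) : I • satPow N I n ≤ satPow N I (n + 1) :=
  Submodule.smul_le.mpr fun _ ha _ hw => smul_mem_satPow I ha hw

theorem exists_pow_smul_le_of_fg {P : Submodule R N} (hP : P.FG) {n : ℕ}
    (h : P ≤ satPow N I n) : ∃ K : ℕ, I ^ K • P ≤ I ^ (K + n) • (⊤ : Submodule R N) := by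
  classical
  obtain ⟨s, rfl⟩ := hP
  induction s using Finset.induction_on with
  | empty => exact ⟨0, by simp⟩
  | insert a s ha ih =>
    rw [Finset.coe_insert, Submodule.span_insert] at h ⊢
    obtain ⟨K, hK⟩ := ih (le_sup_right.trans h)
    obtain ⟨L, hL⟩ := h (Submodule.mem_sup_left (Submodule.mem_span_singleton_self a))
    refine ⟨L + K, ?_⟩
    rw [Submodule.smul_sup]
    refine sup_le (pow_smul_span_le_succ hL K) ?_
    rw [pow_add, mul_smul, add_assoc, pow_add I L, mul_smul]
    exact smul_mono_right _ hK

/-- This colon property, which fails in general for the powers themselves, is the reason for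
saturating. -/
theorem mem_satPow_of_smul_mem {s : Set R} (hs : Ideal.span s = I) (hI : I.FG) {n : ℕ} {w : N}
    (h : ∀ a ∈ s, a • w ∈ satPow N I (n + 1)) : w ∈ satPow N I n := by
  have h1 : I • (R ∙ w) ≤ satPow N I (n + 1) := by
    rw [← hs, Submodule.span_smul_span, Submodule.span_le, hs]
    rintro _ ⟨a, ha, b, rfl, rfl⟩
    exact h a ha
  obtain ⟨K, hK⟩ := exists_pow_smul_le_of_fg I
    (Submodule.FG.smul hI (Submodule.fg_span_singleton w)) h1
  refine ⟨K + 1, ?_⟩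
  rw [pow_succ, mul_smul]
  convert hK using 3
  omega

/-- The filtration with terms F_{i+1} ∩ I^i N lies in the I-adic one, so it is stable by Artin–Rees.
A single K for one finitely generated term then controls all later terms. -/
theorem exists_inf_satPow_le [IsNoetherianRing R] [Module.Finite R N] :
    ∃ n₀ : ℕ, ∀ j, satPow N I (n₀ + j) ⊓ I ^ n₀ • (⊤ : Submodule R N) ≤ I ^ (n₀ + j) • ⊤ := by
  let G : I.Filtration N :=
    { N := fun i => satPow N I (i + 1) ⊓ I ^ i • ⊤
      mono := fun i => inf_le_inf (satPow_antitone I (by omega))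
        (Submodule.smul_mono_left (Ideal.pow_le_pow_right (by omega)))
      smul_le := fun i => by
        refine le_inf ((smul_mono_right _ inf_le_left).trans (smul_satPow_le I _)) ?_
        refine (smul_mono_right _ inf_le_right).trans ?_
        rw [← mul_smul, ← pow_succ'] }
  have hle : G ≤ I.stableFiltration ⊤ := fun i => inf_le_right
  obtain ⟨n₁, h₁⟩ := ((I.stableFiltration_stable ⊤).of_le hle).exists_pow_smul_eq
  obtain ⟨K, hK⟩ := exists_pow_smul_le_of_fg I (IsNoetherian.noetherian (G.N n₁))
    (n := n₁ + 1) inf_le_left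
  have h2 : ∀ j, G.N (n₁ + K + j) ≤ I ^ (n₁ + K + j + 1) • ⊤ := by
    intro j
    rw [add_assoc, h₁, add_comm K j, pow_add, mul_smul]
    refine (smul_mono_right _ hK).trans ?_
    rw [← mul_smul, ← pow_add]
    exact Submodule.smul_mono_left (Ideal.pow_le_pow_right (by omega))
  refine ⟨n₁ + K, fun j => ?_⟩
  induction j with
  | zero => exact inf_le_right
  | succ j ih =>
    exact le_trans (le_inf inf_le_left
      ((inf_le_inf_right _ (satPow_antitone I (by omega))).trans ih)) (h2 j)

theorem pow_smul_mem_satPow {y : R} (hy : y ∈ I) {n : ℕ} {w : N} (hw : w ∈ satPow N I n) (k : ℕ) :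
    y ^ k • w ∈ satPow N I (k + n) := by
  induction k with
  | zero => simpa using hw
  | succ k ih =>
    rw [pow_succ', mul_smul, Nat.add_right_comm]
    exact smul_mem_satPow I hy ih

/-- Multiplication by y^n₀ moves w into I^n₀ N, where the saturation adds nothing. Artin–Rees for
y^n₀ N and regularity of y allow the factor to be cancelled. -/
theorem exists_satPow_add_le [IsNoetherianRing R] [Module.Finite R N] {y : R} (hy : y ∈ I)
    (hreg : IsSMulRegular N y) :
    ∃ c : ℕ, ∀ n, satPow N I (n + c) ≤ I ^ n • (⊤ : Submodule R N) := by
  obtain ⟨n₀, h₀⟩ := exists_inf_satPow_le (N := N) I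
  have hz : ∀ n, ∀ w ∈ satPow N I n, y ^ n₀ • w ∈ I ^ (n₀ + n) • (⊤ : Submodule R N) := by
    intro n w hw
    exact h₀ n ⟨pow_smul_mem_satPow I hy hw n₀,
      Submodule.smul_mem_smul (Ideal.pow_mem_pow hy _) trivial⟩
  obtain ⟨k, hk⟩ := I.exists_pow_inf_eq_pow_smul
    (LinearMap.range (LinearMap.lsmul R N (y ^ n₀)))
  refine ⟨k, fun n w hw => ?_⟩
  have h1 := hz _ w hw
  have h2 : y ^ n₀ • w ∈ I ^ (n₀ + (n + k) - k) • LinearMap.range (LinearMap.lsmul R N (y ^ n₀)) := by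
    exact Submodule.smul_mono le_rfl inf_le_right ((hk _ (by omega)).le ⟨h1, ⟨w, rfl⟩⟩)
  rw [LinearMap.range_eq_map, ← Submodule.map_smul''] at h2
  obtain ⟨w', hw', he⟩ := h2
  have : w' = w := (hreg.pow n₀) he
  subst this
  exact Submodule.smul_mono_left (Ideal.pow_le_pow_right (by omega)) hw'

end SaturatedPower

/-! ### Polynomials with coefficients in a module, and a McCoy-type lemma. -/

section PolynomialModules

variable {R : Type*} [CommRing R] {N : Type*} [AddCommGroup N] [Module R N]

theorem coeff_sub_apply (x y : PolynomialModule R N) (k : ℕ) :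
    (x - y).coeff k = x.coeff k - y.coeff k := rfl

theorem coeff_smul_apply (a : R) (x : PolynomialModule R N) (k : ℕ) :
    (a • x).coeff k = a • x.coeff k := rfl

theorem exists_coeff_eq_zero (w : PolynomialModule R N) : ∃ d, ∀ i, d ≤ i → w.coeff i = 0 := by
  obtain ⟨d, hd⟩ := w.coeff.support.exists_nat_subset_range
  refine ⟨d, fun i hi => ?_⟩
  by_contra hne
  exact absurd (Finset.mem_range.mp (hd (Finsupp.mem_support_iff.mpr hne))) (by omega)

/-- As in McCoy's theorem on zero divisors of polynomials, the products x_i w_k are treated one i at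
a time from the top, with an outer induction on the degree of w. -/
theorem coeff_mem_of_smul_coeff_mem {I : Ideal R} {F : ℕ → Submodule R N}
    (hmul : ∀ n, ∀ a ∈ I, ∀ w ∈ F n, a • w ∈ F (n + 1)) {x : R[X]} (hx : ∀ i, x.coeff i ∈ I)
    (hsat : ∀ n w, (∀ i, x.coeff i • w ∈ F (n + 1)) → w ∈ F n) (d : ℕ) :
    ∀ (n : ℕ) (w : PolynomialModule R N), (∀ i, d ≤ i → w.coeff i = 0) →
      (∀ i, (x • w).coeff i ∈ F (n + 1)) → ∀ i, w.coeff i ∈ F n := by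
  induction d with
  | zero =>
    intro n w hw _ i
    rw [hw i (Nat.zero_le i)]
    exact zero_mem _
  | succ d ih =>
    intro n w hw hxw
    -- Descending induction on i, begun above the degree of x.
    have key : ∀ j i, x.natDegree < i + j → ∀ k, x.coeff i • w.coeff k ∈ F (n + 1) := by
      intro j
      induction j with
      | zero =>
        intro i hi k
        rw [Polynomial.coeff_eq_zero_of_natDegree_lt (by omega), zero_smul]
        exact zero_mem _
      | succ j ihj =>
        intro i hi
        have htop : x.coeff i • w.coeff d ∈ F (n + 1) := by
          have h := hxw (i + d)
          rw [PolynomialModule.smul_apply,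
            ← Finset.add_sum_erase _ _
              (show (i, d) ∈ Finset.HasAntidiagonal.antidiagonal (i + d) by simp)] at h
          refine (Submodule.add_mem_iff_left _ (Submodule.sum_mem _ ?_)).mp h
          rintro ⟨p, q⟩ hpq
          rw [Finset.mem_erase, Finset.HasAntidiagonal.mem_antidiagonal] at hpq
          obtain ⟨hne, hpq⟩ := hpq
          dsimp only at hpq ⊢
          rcases lt_trichotomy q d with hq | hq | hq
          · exact ihj p (by omega) q
          · exact absurd (Prod.ext (by dsimp only; omega) hq) hne
          · rw [hw q hq, smul_zero]
            exact zero_mem _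
        -- Without its top term w has smaller degree, and the factor x_i pays for replacing n by n +
        -- 1 in the outer induction hypothesis.
        have hlow : ∀ k, (x.coeff i • (w - PolynomialModule.single R d (w.coeff d))).coeff k
            ∈ F (n + 1) := by
          refine ih (n + 1) _ ?_ ?_
          · intro k hk
            rcases hk.eq_or_lt with rfl | hk
            · simp [coeff_smul_apply, coeff_sub_apply]
            · simp [coeff_smul_apply, coeff_sub_apply, hw k hk, show d ≠ k by omega]
          · intro k
            rw [smul_comm, smul_sub, smul_sub, coeff_sub_apply]
            refine sub_mem (hmul _ _ (hx i) _ (hxw k)) ?_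
            rw [smul_comm, ← PolynomialModule.single_smul, PolynomialModule.smul_single_apply]
            split_ifs
            · exact hmul _ _ (hx _) _ htop
            · exact zero_mem _
        intro k
        by_cases hk : k = d
        · exact hk ▸ htop
        · have := hlow k
          simpa [coeff_smul_apply, coeff_sub_apply, Finsupp.single_apply, Ne.symm hk] using this
    intro k
    exact hsat n _ fun i => key (x.natDegree + 1) i (by omega) k

theorem coeff_mem_of_forall_smul_coeff_mem {I : Ideal R} {F : ℕ → Submodule R N}
    (hmul : ∀ n, ∀ a ∈ I, ∀ w ∈ F n, a • w ∈ F (n + 1)) {x : R[X]} (hx : ∀ i, x.coeff i ∈ I)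
    (hsat : ∀ n w, (∀ i, x.coeff i • w ∈ F (n + 1)) → w ∈ F n) {n : ℕ} {w : PolynomialModule R N}
    (h : ∀ i, (x • w).coeff i ∈ F (n + 1)) (i : ℕ) : w.coeff i ∈ F n := by
  obtain ⟨d, hd⟩ := exists_coeff_eq_zero w
  exact coeff_mem_of_smul_coeff_mem hmul hx hsat d n w hd h i

variable (N) in
/-- The `R`-linear embedding of `p`-tuples as the polynomials of degree less than `p`. -/
noncomputable def ofTuple (p : ℕ) : (Fin p → N) →ₗ[R] PolynomialModule R N :=
  ∑ i : Fin p, PolynomialModule.lsingle R (i : ℕ) ∘ₗ LinearMap.proj i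

theorem coeff_ofTuple {p : ℕ} (w : Fin p → N) (k : ℕ) :
    (ofTuple (R := R) N p w).coeff k = if h : k < p then w ⟨k, h⟩ else 0 := by
  simp only [ofTuple, LinearMap.sum_apply, LinearMap.comp_apply, LinearMap.proj_apply,
    PolynomialModule.coeff_sum, Finsupp.finsetSum_apply, PolynomialModule.lsingle_apply]
  split_ifs with h
  · rw [Finset.sum_eq_single ⟨k, h⟩]
    · simp
    · intro b _ hb
      rw [if_neg]
      exact fun h => hb (Fin.ext h)
    · simp
  · exact Finset.sum_eq_zero fun i _ => if_neg (by omega)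

theorem ofTuple_coeff {p : ℕ} {w : PolynomialModule R N} (hw : ∀ i, p ≤ i → w.coeff i = 0) :
    ofTuple N p (fun i => w.coeff i) = w := by
  apply PolynomialModule.coeff_injective
  ext k
  rw [coeff_ofTuple]
  split_ifs with h
  · rfl
  · exact (hw k (by omega)).symm

end PolynomialModules

/-! ### Comparison of lengths through polynomials of bounded degree. -/

section RelativeLength

variable {R : Type*} [CommRing R] {N : Type*} [AddCommGroup N] [Module R N]

/-- The length of `A / (A ∩ F)`. -/
noncomputable def relLength (A F : Submodule R N) : ℕ∞ := Module.length R (A ⧸ F.submoduleOf A)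

theorem relLength_top (F : Submodule R N) : relLength ⊤ F = Module.length R (N ⧸ F) := by
  refine (Submodule.Quotient.equiv _ _ Submodule.topEquiv ?_).length_eq
  ext x
  simp [Submodule.submoduleOf]

theorem length_quotient_eq_add {A F : Submodule R N} (h : F ≤ A) :
    Module.length R (N ⧸ F) = relLength A F + Module.length R (N ⧸ A) := by
  have hle : F.submoduleOf A ≤ F.comap A.subtype := le_rfl
  refine Module.length_eq_add_of_exact (Submodule.mapQ _ F A.subtype hle) (Submodule.factor h)
    ?_ (Submodule.factor_surjective h) ?_
  · rw [← LinearMap.ker_eq_bot, Submodule.ker_mapQ]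
    exact Submodule.mkQ_map_self _
  · rw [LinearMap.exact_iff, Submodule.range_mapQ, Submodule.factor, Submodule.ker_mapQ]
    simp

/-- `A` is a quotient of G / ker g, which embeds in `B`. -/
theorem length_le_of_ker_le {G A B : Type*} [AddCommGroup G] [Module R G] [AddCommGroup A]
    [Module R A] [AddCommGroup B] [Module R B] (f : G →ₗ[R] A) (g : G →ₗ[R] B)
    (hf : Function.Surjective f) (h : LinearMap.ker g ≤ LinearMap.ker f) :
    Module.length R A ≤ Module.length R B := by
  refine le_trans (Module.length_le_of_surjective ((LinearMap.ker g).liftQ f h) ?_)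
    (Module.length_le_of_injective ((LinearMap.ker g).liftQ g le_rfl) ?_)
  · exact fun a => let ⟨b, hb⟩ := hf a; ⟨Submodule.Quotient.mk b, hb⟩
  · rw [← LinearMap.ker_eq_bot, Submodule.ker_liftQ_eq_bot]
    exact le_rfl

theorem le_of_forall_natCast_mul_le {a b : ℕ∞} {s : ℕ}
    (h : ∀ p : ℕ, (p : ℕ∞) * a ≤ ((p + s : ℕ) : ℕ∞) * b) : a ≤ b := by
  induction b using ENat.recTopCoe with
  | top => exact le_top
  | coe b =>
    induction a using ENat.recTopCoe with
    | top =>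
      have := h 1
      simp only [Nat.cast_one, one_mul, top_le_iff] at this
      exact absurd this (by rw [← Nat.cast_mul]; exact ENat.natCast_ne_top _)
    | coe a =>
      have h1 : ∀ p : ℕ, p * a ≤ (p + s) * b := fun p => by exact_mod_cast h p
      by_contra hlt
      have hlt : b < a := by
        rw [not_le] at hlt
        exact_mod_cast hlt
      -- For p > s b the number p (b + 1) exceeds (p + s) b.
      have := h1 (s * b + 1)
      have h3 := Nat.mul_le_mul_left (s * b + 1) hlt
      nlinarith

variable {N' : Type*} [AddCommGroup N'] [Module R N']

/-- A relation between polynomial modules that raises degrees by a bounded amount and reflects the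
submodule `F'` into `F` shows `ℓ(A / F) ≤ ℓ(B / F')`. -/
theorem relLength_le_of_relation (Γ : Submodule R (PolynomialModule R N × PolynomialModule R N'))
    {A F : Submodule R N} {B F' : Submodule R N'} (s : ℕ)
    (h₁ : ∀ (p : ℕ) (w : PolynomialModule R N), (∀ i, w.coeff i ∈ A) →
      (∀ i, p ≤ i → w.coeff i = 0) →
      ∃ v, (w, v) ∈ Γ ∧ (∀ i, v.coeff i ∈ B) ∧ ∀ i, p + s ≤ i → v.coeff i = 0)
    (h₂ : ∀ w v, (w, v) ∈ Γ → (∀ i, w.coeff i ∈ A) → (∀ i, v.coeff i ∈ F') →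
      ∀ i, w.coeff i ∈ F) :
    relLength A F ≤ relLength B F' := by
  refine le_of_forall_natCast_mul_le (s := s) fun p => ?_
  let iA : (Fin p → A) →ₗ[R] PolynomialModule R N :=
    ofTuple N p ∘ₗ LinearMap.pi fun i => A.subtype ∘ₗ LinearMap.proj i
  let iB : (Fin (p + s) → B) →ₗ[R] PolynomialModule R N' :=
    ofTuple N' (p + s) ∘ₗ LinearMap.pi fun i => B.subtype ∘ₗ LinearMap.proj i
  -- The relation cut down to degrees below p and p + s: it maps onto the p-tuples in A / F, and
  -- what vanishes modulo F' vanishes modulo F.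
  let G : Submodule R ((Fin p → A) × (Fin (p + s) → B)) := Γ.comap (iA.prodMap iB)
  let f : G →ₗ[R] (Fin p → A ⧸ F.submoduleOf A) :=
    (LinearMap.pi fun i => (F.submoduleOf A).mkQ ∘ₗ LinearMap.proj i) ∘ₗ
      LinearMap.fst R _ _ ∘ₗ G.subtype
  let g : G →ₗ[R] (Fin (p + s) → B ⧸ F'.submoduleOf B) :=
    (LinearMap.pi fun i => (F'.submoduleOf B).mkQ ∘ₗ LinearMap.proj i) ∘ₗ
      LinearMap.snd R _ _ ∘ₗ G.subtype
  have hiA : ∀ (w : Fin p → A) k, (iA w).coeff k = if h : k < p then (w ⟨k, h⟩ : N) else 0 :=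
    fun w k => coeff_ofTuple _ _
  have hiB : ∀ (w : Fin (p + s) → B) k,
      (iB w).coeff k = if h : k < p + s then (w ⟨k, h⟩ : N') else 0 :=
    fun w k => coeff_ofTuple _ _
  have memA : ∀ w k, (iA w).coeff k ∈ A := by
    intro w k
    rw [hiA]
    split_ifs
    · exact Subtype.coe_prop _
    · exact zero_mem _
  have := length_le_of_ker_le f g ?_ ?_
  · simpa [relLength] using this
  · intro a
    choose w hw using fun i => Submodule.mkQ_surjective (F.submoduleOf A) (a i)
    obtain ⟨v, hv, hvB, hv0⟩ := h₁ p (iA w) (memA w) (fun i hi => by rw [hiA, dif_neg (by omega)])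
    refine ⟨⟨(w, fun i => ⟨v.coeff i, hvB i⟩), ?_⟩, funext hw⟩
    change (iA w, iB fun i => ⟨v.coeff i, hvB i⟩) ∈ Γ
    convert hv
    exact ofTuple_coeff hv0
  · rintro ⟨⟨w, v⟩, hwv⟩ hg
    rw [LinearMap.mem_ker] at hg ⊢
    have hv : ∀ i, (iB v).coeff i ∈ F' := by
      intro i
      rw [hiB]
      split_ifs with h
      · have := congrFun hg ⟨i, h⟩
        exact (Submodule.Quotient.mk_eq_zero (F'.submoduleOf B)).mp this
      · exact zero_mem _
    have hw := h₂ _ _ hwv (memA w) hv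
    ext i
    refine (Submodule.Quotient.mk_eq_zero _).mpr ?_
    have : (iA w).coeff i ∈ F := hw i
    rw [hiA, dif_pos i.2] at this
    exact this

end RelativeLength

/-! ### Finite lengths, and multiplicity as a linear growth rate. -/

section FiniteLength

variable {R : Type*} [CommRing R] {N : Type*} [AddCommGroup N] [Module R N]

theorem isSMulRegular_of_mem_nonZeroDivisors [Module.IsTorsionFree R N] {z : R}
    (hz : z ∈ nonZeroDivisors R) : IsSMulRegular N z :=
  (isRegular_iff_mem_nonZeroDivisors.mpr hz).isSMulRegular

theorem length_quotient_span_smul_top_ne_top [IsNoetherianRing R] [Ring.KrullDimLE 1 R]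
    [Module.Finite R N] {z : R} (hz : z ∈ nonZeroDivisors R) :
    Module.length R (N ⧸ (Ideal.span {z} • ⊤ : Submodule R N)) ≠ ⊤ := by
  obtain ⟨n, f, hf⟩ := Module.Finite.exists_fin' R N
  have hfin := Module.length_ne_top_iff.mpr (isFiniteLength_quotient_span_singleton R hz)
  have hle := length_le_of_ker_le ((Ideal.span {z} • ⊤ : Submodule R N).mkQ ∘ₗ f)
    (LinearMap.pi fun i : Fin n => (Ideal.span {z}).mkQ ∘ₗ LinearMap.proj i)
    ((Submodule.mkQ_surjective _).comp hf) ?_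
  · refine ne_top_of_le_ne_top ?_ hle
    obtain ⟨C, hC⟩ := ENat.ne_top_iff_exists.mp hfin
    rw [Module.length_pi, ← hC]
    simp only [ENat.card_eq_coe_fintype_card, Fintype.card_fin, ← Nat.cast_mul]
    exact ENat.natCast_ne_top _
  · intro v hv
    have h : ∀ i, ∃ c, c * z = v i := fun i =>
      Ideal.mem_span_singleton'.mp ((Submodule.Quotient.mk_eq_zero _).mp (congrFun hv i))
    choose c hc using h
    have hvc : v = z • c := by
      ext i
      simp [← hc i, mul_comm]
    rw [LinearMap.mem_ker, LinearMap.comp_apply, Submodule.mkQ_apply, Submodule.Quotient.mk_eq_zero,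
      hvc, map_smul]
    exact Submodule.smul_mem_smul (Ideal.mem_span_singleton_self z) trivial

/-- Multiplication by z maps N / z^n N onto z N / z^(n+1) N. -/
theorem length_quotient_span_pow_le (z : R) (n : ℕ) :
    Module.length R (N ⧸ (Ideal.span {z} ^ n • ⊤ : Submodule R N)) ≤
      n * Module.length R (N ⧸ (Ideal.span {z} • ⊤ : Submodule R N)) := by
  induction n with
  | zero =>
    have : Subsingleton (N ⧸ (Ideal.span {z} ^ 0 • ⊤ : Submodule R N)) :=
      Submodule.Quotient.subsingleton_iff.mpr (by simp)
    simp
  | succ n ih =>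
    have hle : (Ideal.span {z} ^ (n + 1) • ⊤ : Submodule R N) ≤ Ideal.span {z} • ⊤ :=
      Submodule.smul_mono_left (Ideal.pow_le_self (by omega))
    rw [length_quotient_eq_add hle, Nat.cast_succ, add_mul, one_mul]
    refine add_le_add ?_ le_rfl
    refine le_trans ?_ ih
    refine Module.length_le_of_surjective (Submodule.mapQ _ _
      ((LinearMap.lsmul R N z).codRestrict (Ideal.span {z} • ⊤) fun w =>
        Submodule.smul_mem_smul (Ideal.mem_span_singleton_self z) trivial) ?_) ?_
    · intro w hw
      change z • w ∈ (Ideal.span {z} ^ (n + 1) • ⊤ : Submodule R N)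
      rw [pow_succ', mul_smul]
      exact Submodule.smul_mem_smul (Ideal.mem_span_singleton_self z) hw
    · intro q
      obtain ⟨⟨w, hw⟩, rfl⟩ := Submodule.mkQ_surjective _ q
      rw [Submodule.ideal_span_singleton_smul] at hw
      obtain ⟨w', -, rfl⟩ := hw
      exact ⟨Submodule.Quotient.mk w', rfl⟩

theorem length_quotient_pow_le {I : Ideal R} {y : R} (hy : y ∈ I) (n : ℕ) :
    Module.length R (N ⧸ (I ^ n • ⊤ : Submodule R N)) ≤
      n * Module.length R (N ⧸ (Ideal.span {y} • ⊤ : Submodule R N)) := by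
  refine le_trans ?_ (length_quotient_span_pow_le y n)
  refine Module.length_le_of_surjective (Submodule.factor ?_) (Submodule.factor_surjective _)
  exact Submodule.smul_mono_left (Ideal.pow_right_mono
    ((Ideal.span_singleton_le_iff_mem _).mpr hy) n)

variable (N) in
/-- `ℓ(N / I ^ n N)` is `e * n` up to a bounded error. -/
def HasMult (I : Ideal R) (e : ℕ) : Prop :=
  ∃ D : ℕ, ∀ n : ℕ, Module.length R (N ⧸ (I ^ n • ⊤ : Submodule R N)) ≤ (e * n + D : ℕ) ∧
    ((e * n : ℕ) : ℕ∞) ≤ Module.length R (N ⧸ (I ^ n • ⊤ : Submodule R N)) + D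

theorem le_of_forall_mul_le_add {a b D : ℕ} (h : ∀ n, a * n ≤ b * n + D) : a ≤ b := by
  by_contra hlt
  have h1 := h (D + 1)
  have h2 := Nat.mul_le_mul_right (D + 1) (not_le.mp hlt)
  rw [Nat.succ_mul] at h2
  omega

theorem HasMult.unique {I : Ideal R} {e e' : ℕ} (h : HasMult N I e) (h' : HasMult N I e') :
    e = e' := by
  obtain ⟨D, hD⟩ := h
  obtain ⟨D', hD'⟩ := h'
  refine le_antisymm (le_of_forall_mul_le_add (D := D' + D) fun n => ?_)
    (le_of_forall_mul_le_add (D := D + D') fun n => ?_)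
  · have := (hD n).2.trans (add_le_add_left (hD' n).1 _)
    rw [← add_assoc]
    exact_mod_cast this
  · have := (hD' n).2.trans (add_le_add_left (hD n).1 _)
    rw [← add_assoc]
    exact_mod_cast this

theorem HasMult.tendsto {I : Ideal R} {e : ℕ} (h : HasMult N I e) :
    Filter.Tendsto (fun n : ℕ =>
      ((Module.length R (N ⧸ (I ^ n • ⊤ : Submodule R N))).toNat : ℝ) / (n : ℝ)) Filter.atTop
      (nhds (e : ℝ)) := by
  obtain ⟨D, hD⟩ := h
  have hb : ∀ n : ℕ, ((Module.length R (N ⧸ (I ^ n • ⊤ : Submodule R N))).toNat : ℝ) ≤ e * n + D ∧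
      (e * n : ℝ) ≤ ((Module.length R (N ⧸ (I ^ n • ⊤ : Submodule R N))).toNat : ℝ) + D := by
    intro n
    obtain ⟨h1, h2⟩ := hD n
    generalize Module.length R (N ⧸ (I ^ n • ⊤ : Submodule R N)) = l at h1 h2 ⊢
    lift l to ℕ using ne_top_of_le_ne_top (ENat.natCast_ne_top _) h1
    rw [ENat.toNat_natCast]
    exact ⟨by exact_mod_cast h1, by exact_mod_cast h2⟩
  have hD0 : Filter.Tendsto (fun n : ℕ => (D : ℝ) / n) Filter.atTop (nhds 0) :=
    tendsto_const_div_atTop_nhds_zero_nat _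
  refine tendsto_of_tendsto_of_tendsto_of_le_of_le'
    (g := fun n : ℕ => (e : ℝ) - D / n) (h := fun n : ℕ => (e : ℝ) + D / n)
    (by simpa using hD0.const_sub (e : ℝ)) (by simpa using hD0.const_add (e : ℝ)) ?_ ?_
  · filter_upwards [Filter.eventually_gt_atTop 0] with n hn
    have hn' : (0 : ℝ) < n := by exact_mod_cast hn
    rw [le_div_iff₀ hn', sub_mul, div_mul_cancel₀ _ hn'.ne']
    linarith [(hb n).2]
  · filter_upwards [Filter.eventually_gt_atTop 0] with n hn
    have hn' : (0 : ℝ) < n := by exact_mod_cast hn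
    rw [div_le_iff₀ hn', add_mul, div_mul_cancel₀ _ hn'.ne']
    linarith [(hb n).1]

theorem HasMult.multiplicity_eq {I : Ideal R} {e : ℕ} (h : HasMult N I e) (hd : dim R N = 1) :
    multiplicity I N = e := by
  rw [multiplicity, hd]
  simpa using h.tendsto.limUnder_eq

variable {N' : Type*} [AddCommGroup N'] [Module R N']

/-- The image of f contains z N', so the map induced by f has a cokernel that is a quotient of N' /
z N'. The error does not depend on n. -/
theorem length_quotient_pow_le_add (I : Ideal R) {z : R} (f : N →ₗ[R] N') (g : N' →ₗ[R] N)
    (hfg : ∀ w, f (g w) = z • w) (n : ℕ) :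
    Module.length R (N' ⧸ (I ^ n • ⊤ : Submodule R N')) ≤
      Module.length R (N ⧸ (I ^ n • ⊤ : Submodule R N)) +
        Module.length R (N' ⧸ (Ideal.span {z} • ⊤ : Submodule R N')) := by
  have hf : (I ^ n • ⊤ : Submodule R N) ≤ (I ^ n • ⊤ : Submodule R N').comap f := by
    rw [← Submodule.map_le_iff_le_comap, Submodule.map_smul'']
    exact smul_mono_right _ le_top
  let F := Submodule.mapQ _ _ f hf
  rw [Module.length_eq_add_of_exact (LinearMap.range F).subtype (LinearMap.range F).mkQ
    (Submodule.subtype_injective _) (Submodule.mkQ_surjective _) (LinearMap.exact_subtype_mkQ _)]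
  refine add_le_add (Module.length_le_of_surjective F.rangeRestrict F.surjective_rangeRestrict) ?_
  refine Module.length_le_of_surjective (Submodule.liftQ _
    ((LinearMap.range F).mkQ ∘ₗ (I ^ n • ⊤ : Submodule R N').mkQ) ?_) ?_
  · rw [Submodule.ideal_span_singleton_smul]
    rintro _ ⟨w, -, rfl⟩
    rw [LinearMap.mem_ker, LinearMap.comp_apply]
    refine (Submodule.Quotient.mk_eq_zero _).mpr ⟨Submodule.Quotient.mk (g w), ?_⟩
    exact congrArg Submodule.Quotient.mk (hfg w)
  · intro q
    obtain ⟨q, rfl⟩ := Submodule.mkQ_surjective _ q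
    obtain ⟨q, rfl⟩ := Submodule.mkQ_surjective _ q
    exact ⟨Submodule.Quotient.mk q, rfl⟩

theorem HasMult.of_quasi [IsNoetherianRing R] [Ring.KrullDimLE 1 R] [Module.Finite R N]
    [Module.Finite R N'] {I : Ideal R} {e : ℕ} (h : HasMult N I e) {z : R}
    (hz : z ∈ nonZeroDivisors R) (f : N →ₗ[R] N') (g : N' →ₗ[R] N)
    (hfg : ∀ w, f (g w) = z • w) (hgf : ∀ w, g (f w) = z • w) : HasMult N' I e := by
  obtain ⟨D, hD⟩ := h
  obtain ⟨C, hC⟩ := ENat.ne_top_iff_exists.mp (length_quotient_span_smul_top_ne_top (N := N) hz)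
  obtain ⟨C', hC'⟩ := ENat.ne_top_iff_exists.mp (length_quotient_span_smul_top_ne_top (N := N') hz)
  refine ⟨C + C' + D, fun n => ⟨?_, ?_⟩⟩
  · refine (length_quotient_pow_le_add I f g hfg n).trans ?_
    rw [← hC']
    refine (add_le_add_left (hD n).1 _).trans ?_
    norm_cast
    omega
  · refine (hD n).2.trans ((add_le_add_left (length_quotient_pow_le_add I g f hgf n) _).trans ?_)
    rw [← hC]
    push_cast
    rw [add_assoc]
    refine add_le_add_right ?_ _
    norm_cast
    omega

theorem pi_smul_top {ι : Type*} [Fintype ι] (I : Ideal R) :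
    (I • ⊤ : Submodule R (ι → R)) = Submodule.pi Set.univ fun _ => I := by
  classical
  refine le_antisymm (Submodule.smul_le.mpr fun a ha w _ i _ => I.mul_mem_right _ ha) fun w hw => ?_
  rw [pi_eq_sum_univ' w]
  exact Submodule.sum_mem _ fun i _ => Submodule.smul_mem_smul (hw i trivial) trivial

theorem HasMult.pi {I : Ideal R} {e : ℕ} (h : HasMult R I e) (r : ℕ) :
    HasMult (Fin r → R) I (r * e) := by
  obtain ⟨D, hD⟩ := h
  have hl : ∀ n, Module.length R ((Fin r → R) ⧸ (I ^ n • ⊤ : Submodule R (Fin r → R))) =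
      r * Module.length R (R ⧸ (I ^ n • ⊤ : Submodule R R)) := by
    intro n
    classical
    rw [(Submodule.quotEquivOfEq _ _ (pi_smul_top (I ^ n))).length_eq,
      (Submodule.quotientPi _).length_eq,
      (Submodule.quotEquivOfEq (I ^ n • ⊤ : Submodule R R) (I ^ n) (by simp)).length_eq]
    simp
  refine ⟨r * D, fun n => ?_⟩
  rw [hl]
  constructor
  · refine (mul_le_mul_right (hD n).1 _).trans (le_of_eq ?_)
    push_cast
    ring
  · have := mul_le_mul_right (hD n).2 (r : ℕ∞)
    push_cast at this ⊢
    rw [mul_add] at this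
    rwa [mul_assoc]

end FiniteLength

/-! ### The generic polynomial of an ideal. -/

section Generic

variable {R : Type*} [CommRing R] {N : Type*} [AddCommGroup N] [Module R N]

/-- A polynomial whose coefficients generate the ideal `I`, with leading coefficient `y`. -/
structure IsGenericPoly (I : Ideal R) (x : R[X]) (y : R) : Prop where
  span_eq : Ideal.span (Set.range x.coeff) = I
  leading : x.coeff x.natDegree = y

theorem IsGenericPoly.coeff_mem {I : Ideal R} {x : R[X]} {y : R} (h : IsGenericPoly I x y) (i : ℕ) :
    x.coeff i ∈ I := h.span_eq ▸ Ideal.subset_span ⟨i, rfl⟩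

theorem exists_isGenericPoly {I : Ideal R} (hI : I.FG) {y : R} (hy : y ∈ I) (hy0 : y ≠ 0) :
    ∃ x : R[X], IsGenericPoly I x y := by
  classical
  obtain ⟨n, s, hs⟩ := Submodule.fg_iff_exists_fin_generating_family.mp hI
  -- The entry y is redundant as a generator; it is appended to become the leading coefficient.
  let x : R[X] := Polynomial.ofFn (n + 1) (Fin.snoc (α := fun _ => R) s y)
  have hlast : x.coeff n = y := by
    refine (Polynomial.ofFn_coeff_eq_val_of_lt _ (Nat.lt_succ_self n)).trans ?_
    exact Fin.snoc_last (α := fun _ => R) _ _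
  have hcast : ∀ i : Fin n, x.coeff i = s i := by
    intro i
    refine (Polynomial.ofFn_coeff_eq_val_of_lt _ (i.2.trans (Nat.lt_succ_self n))).trans ?_
    exact Fin.snoc_castSucc (α := fun _ => R) _ _ i
  have hdeg : x.natDegree = n := by
    refine le_antisymm (Nat.lt_succ_iff.mp (Polynomial.ofFn_natDegree_lt (Nat.succ_pos n) _)) ?_
    exact Polynomial.le_natDegree_of_ne_zero (hlast ▸ hy0)
  refine ⟨x, le_antisymm ?_ ?_, by rw [hdeg, hlast]⟩
  · rw [Ideal.span_le]
    rintro _ ⟨i, rfl⟩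
    rcases lt_trichotomy i n with hi | rfl | hi
    · rw [SetLike.mem_coe, show x.coeff i = s ⟨i, hi⟩ from hcast ⟨i, hi⟩, ← hs]
      exact Submodule.subset_span ⟨_, rfl⟩
    · rwa [SetLike.mem_coe, hlast]
    · rw [Polynomial.coeff_eq_zero_of_natDegree_lt (hdeg ▸ hi)]
      exact zero_mem _
  · rw [← hs]
    refine Submodule.span_mono ?_
    rintro _ ⟨i, rfl⟩
    exact ⟨i, hcast i⟩

variable {I : Ideal R} {x : R[X]} {y : R}

theorem IsGenericPoly.mem_satPow (hx : IsGenericPoly I x y) (hI : I.FG) {n : ℕ}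
    {w : PolynomialModule R N} (h : ∀ i, (x • w).coeff i ∈ satPow N I (n + 1)) (i : ℕ) :
    w.coeff i ∈ satPow N I n :=
  coeff_mem_of_forall_smul_coeff_mem (fun _ _ ha _ hw => smul_mem_satPow I ha hw) hx.coeff_mem
    (fun _ _ h => mem_satPow_of_smul_mem I hx.span_eq hI (by rintro _ ⟨i, rfl⟩; exact h i)) h i

theorem IsGenericPoly.eq_zero_of_smul_eq_zero (hx : IsGenericPoly I x y) (hreg : IsSMulRegular N y)
    {w : PolynomialModule R N} (h : x • w = 0) : w = 0 := by
  apply PolynomialModule.coeff_injective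
  ext i
  -- The constant zero filtration qualifies because the leading coefficient y acts injectively.
  refine coeff_mem_of_forall_smul_coeff_mem (F := fun _ : ℕ => (⊥ : Submodule R N)) (n := 0) (I := I)
    ?_ hx.coeff_mem ?_ (fun k => by rw [h]; exact zero_mem _) i
  · rintro _ a _ w hw
    rw [(Submodule.mem_bot R).mp hw, smul_zero]
    exact zero_mem _
  · intro _ w hw
    have := (Submodule.mem_bot R).mp (hw x.natDegree)
    rw [hx.leading] at this
    exact (Submodule.mem_bot R).mpr (hreg (by simpa using this))

theorem coeff_smul_eq_zero {p s : ℕ} {x : R[X]} (hx : x.natDegree ≤ s) {w : PolynomialModule R N}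
    (hw : ∀ i, p ≤ i → w.coeff i = 0) {i : ℕ} (hi : p + s ≤ i) : (x • w).coeff i = 0 := by
  rw [PolynomialModule.smul_apply]
  refine Finset.sum_eq_zero fun ab hab => ?_
  rw [Finset.HasAntidiagonal.mem_antidiagonal] at hab
  by_cases hb : p ≤ ab.2
  · rw [hw _ hb, smul_zero]
  · rw [Polynomial.coeff_eq_zero_of_natDegree_lt (by omega), zero_smul]

theorem coeff_smul_mem {J : Ideal R} {A : Submodule R N} {x : R[X]} (hx : ∀ i, x.coeff i ∈ J)
    {w : PolynomialModule R N} (hw : ∀ i, w.coeff i ∈ A) (i : ℕ) :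
    (x • w).coeff i ∈ J • A := by
  rw [PolynomialModule.smul_apply]
  exact Submodule.sum_mem _ fun ab _ => Submodule.smul_mem_smul (hx _) (hw _)

/-- The pairs `(w, v)` with `q w = x v`. -/
def smulRelation (N : Type*) [AddCommGroup N] [Module R N] (q x : R[X]) :
    Submodule R (PolynomialModule R N × PolynomialModule R N) where
  carrier := {wv | q • wv.1 = x • wv.2}
  zero_mem' := by simp
  add_mem' := fun ha hb => by
    simp only [Set.mem_ofPred_eq, Prod.fst_add, Prod.snd_add, smul_add] at ha hb ⊢
    rw [ha, hb]
  smul_mem' := fun r a ha => by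
    simp only [Set.mem_ofPred_eq, Prod.smul_fst, Prod.smul_snd] at ha ⊢
    rw [smul_comm, ha, smul_comm]

theorem IsGenericPoly.relLength_le (hx : IsGenericPoly I x y) (hI : I.FG) {A B : Submodule R N}
    (hAB : I • A ≤ B) (n : ℕ) :
    relLength A (satPow N I n) ≤ relLength B (satPow N I (n + 1)) := by
  -- With q = x and x = 1 the relation is the graph of multiplication by the generic polynomial.
  refine relLength_le_of_relation (smulRelation N x 1) x.natDegree ?_ ?_
  · intro p w hw hp
    exact ⟨x • w, (one_smul _ _).symm, fun i => hAB (coeff_smul_mem hx.coeff_mem hw i),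
      fun i hi => coeff_smul_eq_zero le_rfl hp hi⟩
  · intro w v hwv _ hv
    have hwv : x • w = (1 : R[X]) • v := hwv
    rw [one_smul] at hwv
    exact hx.mem_satPow hI fun i => hwv ▸ hv i

end Generic

/-! ### Existence of the multiplicity and the bound on generators. -/

section Asymptotics

theorem eventually_const_of_monotone_of_le {δ : ℕ → ℕ} {C : ℕ} (h : Monotone δ) (hC : ∀ n, δ n ≤ C) :
    ∃ n₀, ∀ n, n₀ ≤ n → δ n = δ n₀ := by
  have hbdd : BddAbove (Set.range δ) := ⟨C, by rintro _ ⟨n, rfl⟩; exact hC n⟩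
  obtain ⟨n₀, hn₀⟩ := Nat.sSup_mem (Set.range_nonempty δ) hbdd
  exact ⟨n₀, fun n hn => le_antisymm (hn₀ ▸ le_csSup hbdd ⟨n, rfl⟩) (h hn)⟩

/-- Linear growth of f bounds the monotone increments δ, so they become constant and g becomes
linear; f is squeezed between g and a shift of g. -/
theorem exists_slope {f g δ : ℕ → ℕ} {C c : ℕ} (hg : ∀ n, g (n + 1) = δ n + g n)
    (hδ : Monotone δ) (hfg : ∀ n, g n ≤ f n) (hgf : ∀ n, f n ≤ g (n + c))
    (hC : ∀ n, f n ≤ n * C) :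
    ∃ e D n₀, (∀ n, n₀ ≤ n → δ n = e) ∧ ∀ n, f n ≤ e * n + D ∧ e * n ≤ f n + D := by
  have hgrow : ∀ n k, g n + k * δ n ≤ g (n + k) := by
    intro n k
    induction k with
    | zero => simp
    | succ k ih =>
      rw [← add_assoc, hg, Nat.succ_mul]
      have := hδ (Nat.le_add_right n k)
      omega
  have hb : ∀ n, δ n ≤ C := by
    intro n
    refine le_of_forall_mul_le_add (D := n * C) fun k => ?_
    have h1 := hgrow n k
    have h2 := (hfg (n + k)).trans (hC (n + k))
    rw [add_mul] at h2
    rw [mul_comm, mul_comm C]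
    omega
  obtain ⟨n₀, hn₀⟩ := eventually_const_of_monotone_of_le hδ hb
  have hlin : ∀ k, g (n₀ + k) = g n₀ + δ n₀ * k := by
    intro k
    induction k with
    | zero => simp
    | succ k ih =>
      rw [← add_assoc, hg, ih, hn₀ _ (Nat.le_add_right _ _), Nat.mul_succ]
      omega
  have hgmono : Monotone g := monotone_nat_of_le_succ fun n => by rw [hg]; omega
  refine ⟨δ n₀, g n₀ + δ n₀ * (n₀ + c), n₀, hn₀, fun n => ⟨?_, ?_⟩⟩
  · have h1 := (hgf n).trans (hgmono (by omega : n + c ≤ n₀ + (n + c)))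
    rw [hlin] at h1
    have h2 : δ n₀ * (n + c) ≤ δ n₀ * n + δ n₀ * (n₀ + c) := by
      rw [← mul_add]
      exact Nat.mul_le_mul_left _ (by omega)
    omega
  · by_cases hn : n₀ ≤ n
    · have h1 := hfg n
      obtain ⟨k, rfl⟩ := Nat.exists_eq_add_of_le hn
      rw [hlin] at h1
      rw [mul_add, mul_add]
      omega
    · have : δ n₀ * n ≤ δ n₀ * (n₀ + c) := Nat.mul_le_mul_left _ (by omega)
      omega

variable {R : Type*} [CommRing R] [IsNoetherianRing R] [Ring.KrullDimLE 1 R] {N : Type*}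
  [AddCommGroup N] [Module R N] [Module.Finite R N] [Module.IsTorsionFree R N] {I : Ideal R} {y : R}

omit [Module.IsTorsionFree R N] in
theorem length_quotient_pow_ne_top (hy : y ∈ I) (hy' : y ∈ nonZeroDivisors R) (n : ℕ) :
    Module.length R (N ⧸ (I ^ n • ⊤ : Submodule R N)) ≠ ⊤ := by
  refine ne_top_of_le_ne_top ?_ (length_quotient_pow_le hy n)
  obtain ⟨C, hC⟩ := ENat.ne_top_iff_exists.mp (length_quotient_span_smul_top_ne_top (N := N) hy')
  rw [← hC, ← Nat.cast_mul]
  exact ENat.natCast_ne_top _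

omit [Module.IsTorsionFree R N] in
theorem length_quotient_satPow_ne_top (hy : y ∈ I) (hy' : y ∈ nonZeroDivisors R) (n : ℕ) :
    Module.length R (N ⧸ satPow N I n) ≠ ⊤ :=
  ne_top_of_le_ne_top (length_quotient_pow_ne_top (N := N) hy hy' n)
    (Module.length_le_of_surjective _ (Submodule.factor_surjective (pow_smul_top_le_satPow I n)))

variable (N) in
/-- A torsion-free module over a one-dimensional ring has a multiplicity `e` with respect to `I`,
which is the eventual increment of the length of `N / satPow N I n` and bounds `ℓ(N / I N)`. -/
theorem exists_hasMult [Nontrivial R] (hy : y ∈ I) (hy' : y ∈ nonZeroDivisors R) :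
    ∃ e : ℕ, HasMult N I e ∧
      (∃ n₀, ∀ n, n₀ ≤ n → Module.length R (N ⧸ satPow N I (n + 1)) =
        e + Module.length R (N ⧸ satPow N I n)) ∧
      Module.length R (N ⧸ (I • ⊤ : Submodule R N)) ≤ e := by
  have hI : I.FG := IsNoetherian.noetherian I
  obtain ⟨x, hx⟩ := exists_isGenericPoly hI hy (nonZeroDivisors.ne_zero hy')
  have hanti := satPow_antitone (N := N) I
  have hrel : ∀ n, Module.length R (N ⧸ satPow N I (n + 1)) =
      relLength (satPow N I n) (satPow N I (n + 1)) + Module.length R (N ⧸ satPow N I n) :=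
    fun n => length_quotient_eq_add (hanti (Nat.le_succ n))
  have hfinF := length_quotient_pow_ne_top (N := N) hy hy'
  have hfinG := length_quotient_satPow_ne_top (N := N) hy hy'
  have hfinδ : ∀ n, relLength (satPow N I n) (satPow N I (n + 1)) ≠ ⊤ := fun n =>
    ne_top_of_le_ne_top (hfinG (n + 1)) (by rw [hrel]; exact le_self_add)
  obtain ⟨C, hC⟩ := ENat.ne_top_iff_exists.mp (length_quotient_span_smul_top_ne_top (N := N) hy')
  choose f hf using fun n => ENat.ne_top_iff_exists.mp (hfinF n)
  choose g hg using fun n => ENat.ne_top_iff_exists.mp (hfinG n)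
  choose δ hδ using fun n => ENat.ne_top_iff_exists.mp (hfinδ n)
  obtain ⟨c, hc⟩ := exists_satPow_add_le I hy (isSMulRegular_of_mem_nonZeroDivisors (N := N) hy')
  obtain ⟨e, D, n₀, he, hD⟩ := exists_slope (f := f) (g := g) (δ := δ) (C := C) (c := c)
    (fun n => by
      have := hrel n
      rw [← hg, ← hg, ← hδ] at this
      exact_mod_cast this)
    (monotone_nat_of_le_succ fun n => by
      have := hx.relLength_le hI (smul_satPow_le (N := N) I n) (n + 1)
      rw [← hδ, ← hδ] at this
      exact_mod_cast this)
    (fun n => by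
      have := Module.length_le_of_surjective _
        (Submodule.factor_surjective (pow_smul_top_le_satPow (N := N) I n))
      rw [← hg, ← hf] at this
      exact_mod_cast this)
    (fun n => by
      have := Module.length_le_of_surjective _ (Submodule.factor_surjective (hc n))
      rw [← hg, ← hf] at this
      exact_mod_cast this)
    (fun n => by
      have := length_quotient_pow_le (N := N) hy n
      rw [← hf, ← hC] at this
      exact_mod_cast this)
  refine ⟨e, ⟨D, fun n => ?_⟩, ⟨n₀, fun n hn => ?_⟩, ?_⟩
  · rw [← hf]
    exact_mod_cast hD n
  · rw [hrel, ← hδ, he n hn]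
  · have hle : satPow N I (n₀ + c + 1) ≤ I • ⊤ := by
      have := hc 1
      rw [pow_one] at this
      exact (hanti (by omega)).trans this
    -- For n = n₀ + c, the length of N / F_{n+1} is both e + ℓ(N / F_n) and ℓ(I N / F_{n+1}) + ℓ(N /
    -- I N), and ℓ(I N / F_{n+1}) ≥ ℓ(N / F_n).
    have h1 := hx.relLength_le hI (A := (⊤ : Submodule R N)) le_rfl (n₀ + c)
    rw [relLength_top] at h1
    have h2 := length_quotient_eq_add hle
    rw [hrel, ← hδ, he _ (by omega)] at h2
    have h3 := add_le_add_left h1 (Module.length R (N ⧸ (I • ⊤ : Submodule R N)))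
    rw [← h2, ← hg, add_comm (e : ℕ∞)] at h3
    exact (ENat.add_le_add_iff_left (ENat.natCast_ne_top _)).mp h3

end Asymptotics

/-! ### A Nakayama lemma with explicit multipliers. -/

section CayleyHamilton

variable {S : Type*} [CommRing S] {P : Type*} [AddCommGroup P] [Module S P]

/-- Cayley–Hamilton for q on the image of `E` modulo `X` gives a monic polynomial with lower
coefficients in `J`; its value at q is q'. For a prime `J` and q outside `J`, also q' is outside
`J`. -/
theorem exists_smul_mem_of_smul_mem_sup {E X : Submodule S P} (hE : E.FG) {J : Ideal S} {q : S}
    (h : ∀ e ∈ E, q • e ∈ X ⊔ J • E) : ∃ (q' : S) (k : ℕ), q' - q ^ k ∈ J ∧ ∀ e ∈ E, q' • e ∈ X := by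
  let M := E.map X.mkQ
  have : Module.Finite S M := Module.Finite.iff_fg.mpr (hE.map _)
  have hr : LinearMap.range (algebraMap S (Module.End S M) q) ≤ J • ⊤ := by
    rintro _ ⟨⟨_, e, he, rfl⟩, rfl⟩
    rw [Submodule.mem_smul_top_iff]
    obtain ⟨a, ha, b, hb, hab⟩ := Submodule.mem_sup.mp (h e he)
    have h1 : q • X.mkQ e = X.mkQ b := by
      rw [← map_smul, ← hab, map_add, Submodule.mkQ_apply X a,
        (Submodule.Quotient.mk_eq_zero X).mpr ha,
        zero_add]
    change q • X.mkQ e ∈ J • E.map X.mkQ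
    rw [h1, ← Submodule.map_smul'']
    exact ⟨b, hb, rfl⟩
  obtain ⟨p, hp, -, hcoeff, haeval⟩ :=
    LinearMap.exists_monic_and_natDegree_eq_and_coeff_mem_pow_and_aeval_eq_zero S _ J hr
  refine ⟨p.eval q, p.natDegree, ?_, fun e he => ?_⟩
  · rw [Polynomial.eval_eq_sum_range, Finset.sum_range_succ, hp.coeff_natDegree, one_mul,
      add_sub_cancel_right]
    refine Submodule.sum_mem _ fun i hi => J.mul_mem_right _ ?_
    rw [Finset.mem_range] at hi
    exact Ideal.pow_le_self (by omega) (hcoeff i)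
  · rw [Polynomial.aeval_algebraMap_apply] at haeval
    have := congrArg Subtype.val (LinearMap.congr_fun haeval ⟨X.mkQ e, e, he, rfl⟩)
    rw [← Submodule.Quotient.mk_eq_zero X]
    simpa using this

end CayleyHamilton

/-! ### Division by the generic polynomial when the number of generators is maximal. -/

section GenericDivision

variable {R : Type*} [CommRing R] {N : Type*} [AddCommGroup N] [Module R N]

variable (R N) in
/-- The `i`-th coefficient as a linear map. -/
noncomputable def coeffHom (i : ℕ) : PolynomialModule R N →ₗ[R] N where
  toFun w := w.coeff i
  map_add' _ _ := rfl
  map_smul' _ _ := rfl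

theorem sum_single_coeff (w : PolynomialModule R N) :
    w = ∑ i ∈ w.coeff.support, PolynomialModule.single R i (w.coeff i) := by
  apply PolynomialModule.coeff_injective
  rw [PolynomialModule.coeff_sum]
  exact (Finsupp.sum_single w.coeff).symm

theorem mem_span_single_of_coeff_mem {s : Set N} {w : PolynomialModule R N}
    (hw : ∀ i, w.coeff i ∈ Submodule.span R s) :
    w ∈ Submodule.span R[X] (PolynomialModule.single R 0 '' s) := by
  have h0 : ∀ b ∈ Submodule.span R s, PolynomialModule.single R 0 b ∈
      Submodule.span R[X] (PolynomialModule.single R 0 '' s) := by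
    intro b hb
    have h : Submodule.span R s ≤ (Submodule.restrictScalars R
        (Submodule.span R[X] (PolynomialModule.single R 0 '' s))).comap
          (PolynomialModule.lsingle R 0) :=
      Submodule.span_le.mpr fun c hc => Submodule.subset_span ⟨c, hc, rfl⟩
    exact h hb
  rw [sum_single_coeff w]
  refine Submodule.sum_mem _ fun i _ => ?_
  have : PolynomialModule.single R i (w.coeff i) =
      monomial i (1 : R) • PolynomialModule.single R 0 (w.coeff i) := by
    rw [PolynomialModule.monomial_smul_single, one_smul, add_zero]
  rw [this]
  exact Submodule.smul_mem _ _ (h0 _ (hw i))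

theorem mem_map_C_smul_of_coeff_mem {I : Ideal R} {B : Submodule R N}
    {E : Submodule R[X] (PolynomialModule R N)} (hE : ∀ i, ∀ b ∈ B, PolynomialModule.single R i b ∈ E)
    {w : PolynomialModule R N} (hw : ∀ i, w.coeff i ∈ I • B) : w ∈ I.map C • E := by
  rw [sum_single_coeff w]
  refine Submodule.sum_mem _ fun i _ => ?_
  have h : I • B ≤ (Submodule.restrictScalars R (I.map C • E)).comap (PolynomialModule.lsingle R i) := by
    refine Submodule.smul_le.mpr fun a ha b hb => ?_
    rw [Submodule.mem_comap, map_smul]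
    change a • PolynomialModule.single R i b ∈ I.map C • E
    rw [← algebraMap_smul R[X] a (PolynomialModule.single R i b)]
    exact Submodule.smul_mem_smul (Ideal.mem_map_of_mem C ha) (hE i b hb)
  exact h (hw i)

/-- After localising at I R[T], multiplication by x would inject N / F into I N / F', of the same
length, and so be onto. The proof is this count in bounded degree. -/
theorem exists_smul_single_sub_mem {I : Ideal R} [I.IsMaximal] {x : R[X]} (hx : ∀ i, x.coeff i ∈ I)
    {F F' : Submodule R N}
    (hF : ∀ w : PolynomialModule R N, (∀ i, (x • w).coeff i ∈ F') → ∀ i, w.coeff i ∈ F) {L : ℕ}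
    (hL : Module.length R (N ⧸ F) = L) (hL' : relLength (I • ⊤) F' = L) {d : N}
    (hd : d ∈ (I • ⊤ : Submodule R N)) :
    ∃ q : R[X], q ∉ I.map C ∧ ∃ v : PolynomialModule R N,
      ∀ i, (q • PolynomialModule.single R 0 d - x • v).coeff i ∈ F' := by
  classical
  by_contra hcon
  push Not at hcon
  let B : Submodule R N := I • ⊤
  let s := x.natDegree
  -- Chosen so that p + s > s L, against the final count p L + (p + s) ≤ (p + s) L.
  let p := s * L + 1
  have hB : ∀ (w : PolynomialModule R N) i, (x • w).coeff i ∈ B := fun w i =>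
    coeff_smul_mem hx (A := ⊤) (fun _ => trivial) i
  let θ₁ : (Fin p → N) →ₗ[R] (Fin (p + s) → B ⧸ F'.submoduleOf B) :=
    LinearMap.pi fun i => (F'.submoduleOf B).mkQ ∘ₗ LinearMap.codRestrict B
      (coeffHom R N i ∘ₗ (LinearMap.lsmul R[X] (PolynomialModule R N) x).restrictScalars R ∘ₗ
        ofTuple N p) fun w => hB _ _
  let θ₂ : (Fin (p + s) → R) →ₗ[R] (Fin (p + s) → B ⧸ F'.submoduleOf B) :=
    LinearMap.pi fun i => (F'.submoduleOf B).mkQ ∘ₗ LinearMap.toSpanSingleton R B ⟨d, hd⟩ ∘ₗ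
      LinearMap.proj i
  have h₁ : ((p * L : ℕ) : ℕ∞) ≤ Module.length R (LinearMap.range θ₁) := by
    have := length_le_of_ker_le
      (LinearMap.pi fun i => F.mkQ ∘ₗ LinearMap.proj i : (Fin p → N) →ₗ[R] (Fin p → N ⧸ F))
      θ₁.rangeRestrict ?_ ?_
    · simpa [hL] using this
    · intro a
      choose w hw using fun i => Submodule.mkQ_surjective F (a i)
      exact ⟨w, funext hw⟩
    · intro w hw
      rw [LinearMap.ker_rangeRestrict, LinearMap.mem_ker] at hw
      have hw' : ∀ i, (x • ofTuple (R := R) N p w).coeff i ∈ F' := by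
        intro i
        by_cases hi : i < p + s
        · exact (Submodule.Quotient.mk_eq_zero (F'.submoduleOf B)).mp (congrFun hw ⟨i, hi⟩)
        · rw [coeff_smul_eq_zero (p := p) le_rfl _ (not_lt.mp hi)]
          · exact zero_mem _
          · intro k hk
            rw [coeff_ofTuple, dif_neg (by omega)]
      ext i
      refine (Submodule.Quotient.mk_eq_zero _).mpr ?_
      have := hF _ hw' i
      rwa [coeff_ofTuple, dif_pos i.2] at this
  -- By the assumed failure, q d can lie in the image of θ₁ only if q has all coefficients in I;
  -- this leaves room for p + s copies of R / I.
  have h₂ : ((p + s : ℕ) : ℕ∞) ≤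
      Module.length R ((Fin (p + s) → B ⧸ F'.submoduleOf B) ⧸ LinearMap.range θ₁) := by
    have hI : Module.length R (R ⧸ I) = 1 := Module.length_eq_one_iff.mpr
      (isSimpleModule_iff_isCoatom.mpr (Ideal.isMaximal_def.mp inferInstance))
    have := length_le_of_ker_le (LinearMap.pi fun i : Fin (p + s) => I.mkQ ∘ₗ LinearMap.proj i)
      ((LinearMap.range θ₁).mkQ ∘ₗ θ₂) ?_ ?_
    · simpa [hI] using this
    · intro a
      choose w hw using fun i => Submodule.mkQ_surjective I (a i)
      exact ⟨w, funext hw⟩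
    · intro q hq
      obtain ⟨w, hw⟩ := (Submodule.Quotient.mk_eq_zero _).mp (LinearMap.mem_ker.mp hq)
      have hcoeff : ∀ i, (Polynomial.ofFn (p + s) q • PolynomialModule.single R 0 d -
          x • ofTuple N p w).coeff i ∈ F' := by
        intro i
        rw [coeff_sub_apply, PolynomialModule.smul_single_apply, if_pos (Nat.zero_le _), Nat.sub_zero]
        by_cases hi : i < p + s
        · rw [Polynomial.ofFn_coeff_eq_val_of_lt _ hi]
          exact (Submodule.Quotient.eq (F'.submoduleOf B)).mp (congrFun hw ⟨i, hi⟩).symm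
        · rw [coeff_smul_eq_zero (p := p) le_rfl _ (not_lt.mp hi),
            Polynomial.ofFn_coeff_eq_zero_of_ge _ (not_lt.mp hi), zero_smul, sub_zero]
          · exact zero_mem _
          · intro k hk
            rw [coeff_ofTuple, dif_neg (by omega)]
      have hmem : Polynomial.ofFn (p + s) q ∈ I.map C := by
        by_contra hnot
        obtain ⟨i, hi⟩ := hcon _ hnot (ofTuple N p w)
        exact hi (hcoeff i)
      rw [Ideal.mem_map_C_iff] at hmem
      ext i
      refine (Submodule.Quotient.mk_eq_zero _).mpr ?_
      have := hmem i
      rwa [Polynomial.ofFn_coeff_eq_val_of_lt _ i.2] at this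
  have h₃ := Module.length_eq_add_of_exact (LinearMap.range θ₁).subtype (LinearMap.range θ₁).mkQ
    (Submodule.subtype_injective _) (Submodule.mkQ_surjective _) (LinearMap.exact_subtype_mkQ _)
  have h₄ : Module.length R (Fin (p + s) → B ⧸ F'.submoduleOf B) = ((p + s) * L : ℕ) := by
    rw [Module.length_pi, show Module.length R (B ⧸ F'.submoduleOf B) = L from hL']
    simp
  rw [h₄] at h₃
  have h₅ := (add_le_add h₁ h₂).trans h₃.ge
  have h₆ : p * L + (p + s) ≤ (p + s) * L := by exact_mod_cast h₅
  rw [add_mul p s L] at h₆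
  have h₇ : p + s ≤ s * L := Nat.le_of_add_le_add_left h₆
  have h₈ : p = s * L + 1 := rfl
  omega

/-- Dividing the generators of m N by x leaves errors in F_{n+1}, hence in m · m N, and
Cayley–Hamilton removes them. The result stands for m N ⊆ x N over the localisation of R[T] at m
R[T]. -/
theorem IsGenericPoly.exists_smul_eq [IsLocalRing R] [IsNoetherianRing R] [Module.Finite R N] {x : R[X]}
    {y : R} (hx : IsGenericPoly (maximalIdeal R) x y) {n L : ℕ}
    (hn : satPow N (maximalIdeal R) (n + 1) ≤ maximalIdeal R ^ 2 • ⊤)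
    (hL : Module.length R (N ⧸ satPow N (maximalIdeal R) n) = L)
    (hL' : relLength (maximalIdeal R • ⊤) (satPow N (maximalIdeal R) (n + 1)) = L) :
    ∃ q : R[X], q ∉ (maximalIdeal R).map C ∧ ∀ u : PolynomialModule R N,
      (∀ i, u.coeff i ∈ (maximalIdeal R • ⊤ : Submodule R N)) → ∃ v, q • u = x • v := by
  classical
  let I := maximalIdeal R
  have hI : I.FG := IsNoetherian.noetherian I
  have hJ : (I.map C).IsPrime := Ideal.isPrime_map_C_of_isPrime
  obtain ⟨s, hs⟩ : (I • ⊤ : Submodule R N).FG := IsNoetherian.noetherian _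
  let E := Submodule.span R[X] (PolynomialModule.single R 0 '' (s : Set N))
  have hE : E.FG := Submodule.fg_span (s.finite_toSet.image _)
  have hmemE : ∀ u : PolynomialModule R N, (∀ i, u.coeff i ∈ (I • ⊤ : Submodule R N)) → u ∈ E :=
    fun u hu => mem_span_single_of_coeff_mem (by rwa [hs])
  have hsingle : ∀ i, ∀ b ∈ (I • ⊤ : Submodule R N), PolynomialModule.single R i b ∈ E := by
    intro i b hb
    refine hmemE _ fun k => ?_
    rw [PolynomialModule.coeff_single, Finsupp.single_apply]
    split_ifs
    · exact hb
    · exact zero_mem _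
  choose! q hq v hv using fun (d : N) (hd : d ∈ (I • ⊤ : Submodule R N)) =>
    exists_smul_single_sub_mem hx.coeff_mem (fun w => hx.mem_satPow hI) hL hL' hd
  let X := LinearMap.range (LinearMap.lsmul R[X] (PolynomialModule R N) x)
  have hsmem : ∀ d ∈ s, d ∈ (I • ⊤ : Submodule R N) := fun d hd => hs ▸ Submodule.subset_span hd
  have hone : ∀ d ∈ s, q d • PolynomialModule.single R 0 d ∈ X ⊔ I.map C • E := by
    intro d hd
    rw [← sub_add_cancel (q d • PolynomialModule.single R 0 d) (x • v d), add_comm]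
    refine Submodule.add_mem_sup ⟨v d, rfl⟩ (mem_map_C_smul_of_coeff_mem hsingle fun i => ?_)
    have := hn (hv d (hsmem d hd) i)
    rwa [pow_two, mul_smul] at this
  have hprod : ∀ e ∈ E, (∏ d ∈ s, q d) • e ∈ X ⊔ I.map C • E := by
    intro e he
    induction he using Submodule.span_induction with
    | mem e he =>
      obtain ⟨d, hd, rfl⟩ := he
      rw [← Finset.prod_erase_mul _ _ hd, mul_smul]
      exact Submodule.smul_mem _ _ (hone d hd)
    | zero => rw [smul_zero]; exact zero_mem _
    | add a b _ _ ha hb => rw [smul_add]; exact add_mem ha hb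
    | smul r a _ ha => rw [smul_comm]; exact Submodule.smul_mem _ _ ha
  obtain ⟨q', k, hq', hdiv⟩ := exists_smul_mem_of_smul_mem_sup hE hprod
  refine ⟨q', fun hmem => ?_, fun u hu => ?_⟩
  · have h1 : (∏ d ∈ s, q d) ^ k ∈ I.map C := by
      have := sub_mem hmem hq'
      rwa [sub_sub_cancel] at this
    obtain ⟨d, hd, hqd⟩ := (hJ.prod_mem_iff).mp (hJ.mem_of_pow_mem k h1)
    exact hq d (hsmem d hd) hqd
  · obtain ⟨v, hv⟩ := hdiv u (hmemE u hu)
    exact ⟨v, hv.symm⟩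

end GenericDivision

/-! ### Maximal number of generators passes to submodules with torsion-free quotient. -/

section TorsionFreeQuotient

variable {R : Type*} [CommRing R] {N : Type*} [AddCommGroup N] [Module R N]
  {N' : Type*} [AddCommGroup N'] [Module R N']

/-- Coefficientwise application of a linear map. -/
noncomputable def mapCoeff (f : N →ₗ[R] N') (w : PolynomialModule R N) : PolynomialModule R N' :=
  .ofCoeff R (w.coeff.mapRange f f.map_zero)

theorem coeff_mapCoeff (f : N →ₗ[R] N') (w : PolynomialModule R N) (k : ℕ) :
    (mapCoeff f w).coeff k = f (w.coeff k) := rfl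

theorem coeff_ext {w v : PolynomialModule R N} (h : ∀ k, w.coeff k = v.coeff k) : w = v :=
  PolynomialModule.coeff_injective (Finsupp.ext h)

theorem mapCoeff_smul (f : N →ₗ[R] N') (q : R[X]) (w : PolynomialModule R N) :
    mapCoeff f (q • w) = q • mapCoeff f w :=
  coeff_ext fun k => by
    simp [coeff_mapCoeff, PolynomialModule.smul_apply, map_sum]

theorem exists_mapCoeff_subtype_eq {H : Submodule R N} {w : PolynomialModule R N}
    (hw : ∀ i, w.coeff i ∈ H) : ∃ v : PolynomialModule R H, mapCoeff H.subtype v = w := by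
  obtain ⟨d, hd⟩ := exists_coeff_eq_zero w
  refine ⟨ofTuple H d fun i => ⟨w.coeff i, hw i⟩, coeff_ext fun k => ?_⟩
  rw [coeff_mapCoeff, coeff_ofTuple]
  split_ifs with h
  · rfl
  · rw [map_zero, hd k (by omega)]

theorem coeff_eq_zero_of_smul_coeff_eq_zero {x : R[X]}
    (hreg : IsSMulRegular N (x.coeff x.natDegree)) {w : PolynomialModule R N} {p : ℕ}
    (h : ∀ i, p ≤ i → (x • w).coeff i = 0) : ∀ i, p ≤ i → w.coeff i = 0 := by
  obtain ⟨d, hd⟩ := exists_coeff_eq_zero w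
  have key : ∀ j i, p ≤ i → d ≤ i + j → w.coeff i = 0 := by
    intro j
    induction j with
    | zero => exact fun i _ hi => hd i hi
    | succ j ih =>
      intro i hi hij
      have h1 := h (x.natDegree + i) (by omega)
      rw [PolynomialModule.smul_apply, Finset.sum_eq_single (x.natDegree, i)] at h1
      · exact hreg (by simpa using h1)
      · rintro ⟨a, b⟩ hab hne
        rw [Finset.HasAntidiagonal.mem_antidiagonal] at hab
        dsimp only at hab ⊢
        rcases lt_trichotomy b i with hb | hb | hb
        · rw [Polynomial.coeff_eq_zero_of_natDegree_lt (by omega), zero_smul]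
        · exact absurd (Prod.ext (by dsimp only; omega) hb) hne
        · rw [ih b (by omega) (by omega), smul_zero]
      · intro hmem
        exact absurd (by simp) hmem
  exact fun i hi => key d i hi (by omega)

/-- The highest coefficient of q outside m is a unit. Comparing coefficients from the top improves
membership in F + m^j N to F + m^(j+1) N, and m^K N ⊆ F ends the process. -/
theorem coeff_mem_of_unit_smul_coeff_mem [IsLocalRing R] {q : R[X]}
    (hq : q ∉ (maximalIdeal R).map C) {F : Submodule R N} {K : ℕ}
    (hF : maximalIdeal R ^ K • ⊤ ≤ F) {u : PolynomialModule R N}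
    (h : ∀ i, (q • u).coeff i ∈ F) (i : ℕ) : u.coeff i ∈ F := by
  classical
  have hex : ∃ t, q.coeff t ∉ maximalIdeal R ∧ ∀ i, t < i → q.coeff i ∈ maximalIdeal R := by
    rw [Ideal.mem_map_C_iff, not_forall] at hq
    obtain ⟨t₀, ht₀⟩ := hq
    have hle : t₀ ≤ q.natDegree :=
      Polynomial.le_natDegree_of_ne_zero fun h => ht₀ (h ▸ zero_mem _)
    refine ⟨Nat.findGreatest (fun t => q.coeff t ∉ maximalIdeal R) q.natDegree,
      Nat.findGreatest_spec (P := fun t => q.coeff t ∉ maximalIdeal R) hle ht₀, fun i hi => ?_⟩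
    by_contra hnot
    by_cases hi' : i ≤ q.natDegree
    · exact Nat.findGreatest_is_greatest hi hi' hnot
    · exact hnot (by rw [Polynomial.coeff_eq_zero_of_natDegree_lt (by omega)]; exact zero_mem _)
  obtain ⟨t, ht, htop⟩ := hex
  obtain ⟨d, hd⟩ := exists_coeff_eq_zero u
  have key : ∀ j k, u.coeff k ∈ F ⊔ maximalIdeal R ^ j • ⊤ := by
    intro j
    induction j with
    | zero => simp
    | succ j ihj =>
      have hle : maximalIdeal R • (F ⊔ maximalIdeal R ^ j • ⊤) ≤
          F ⊔ maximalIdeal R ^ (j + 1) • (⊤ : Submodule R N) := by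
        rw [Submodule.smul_sup, pow_succ', mul_smul]
        exact sup_le_sup_right Submodule.smul_le_right _
      have hdesc : ∀ l k, d ≤ k + l → u.coeff k ∈ F ⊔ maximalIdeal R ^ (j + 1) • ⊤ := by
        intro l
        induction l with
        | zero =>
          intro k hk
          rw [hd k hk]
          exact zero_mem _
        | succ l ih =>
          intro k hk
          have h1 : (q • u).coeff (t + k) ∈ F ⊔ maximalIdeal R ^ (j + 1) • (⊤ : Submodule R N) :=
            Submodule.mem_sup_left (h _)
          rw [PolynomialModule.smul_apply, ← Finset.add_sum_erase _ _
            (show (t, k) ∈ Finset.HasAntidiagonal.antidiagonal (t + k) by simp)] at h1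
          have h2 : q.coeff t • u.coeff k ∈ F ⊔ maximalIdeal R ^ (j + 1) • (⊤ : Submodule R N) := by
            refine (Submodule.add_mem_iff_left _ (Submodule.sum_mem _ ?_)).mp h1
            rintro ⟨a, b⟩ hab
            rw [Finset.mem_erase, Finset.HasAntidiagonal.mem_antidiagonal] at hab
            obtain ⟨hne, hab⟩ := hab
            dsimp only at hab ⊢
            rcases lt_trichotomy b k with hb | hb | hb
            · exact hle (Submodule.smul_mem_smul (htop a (by omega)) (ihj b))
            · exact absurd (Prod.ext (by dsimp only; omega) hb) hne
            · exact Submodule.smul_mem _ _ (ih b (by omega))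
          have hunit : IsUnit (q.coeff t) := by
            by_contra hnot
            exact ht ((mem_maximalIdeal _).mpr hnot)
          exact (Submodule.smul_mem_iff_of_isUnit _ hunit).mp h2
      exact fun k => hdesc d k (by omega)
  exact sup_le le_rfl hF (key K i)

variable [IsLocalRing R] [IsNoetherianRing R] [Ring.KrullDimLE 1 R] [Module.Finite R N]
  [Module.IsTorsionFree R N]

/-- If `ℓ(N / m N)` equals the multiplicity of `N`, then the same holds for every submodule `H` of a
power of `N` with torsion-free quotient. -/
theorem le_length_of_torsionFree_quotient {y : R} (hy : y ∈ maximalIdeal R)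
    (hy' : y ∈ nonZeroDivisors R) {e : ℕ} (he : HasMult N (maximalIdeal R) e)
    (hN : Module.length R (N ⧸ (maximalIdeal R • ⊤ : Submodule R N)) = e) {g : ℕ}
    (H : Submodule R (Fin g → N)) (hH : ∀ u : Fin g → N, y • u ∈ H → u ∈ H) {e' : ℕ}
    (he' : HasMult H (maximalIdeal R) e') :
    (e' : ℕ∞) ≤ Module.length R (H ⧸ (maximalIdeal R • ⊤ : Submodule R H)) := by
  have hI : (maximalIdeal R).FG := IsNoetherian.noetherian _
  obtain ⟨x, hx⟩ := exists_isGenericPoly hI hy (nonZeroDivisors.ne_zero hy')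
  have hregN : IsSMulRegular N y := isSMulRegular_of_mem_nonZeroDivisors hy'
  have hregH : IsSMulRegular H y := isSMulRegular_of_mem_nonZeroDivisors (N := H) hy'
  have hregQ : IsSMulRegular ((Fin g → N) ⧸ H) y := by
    refine isSMulRegular_iff_right_eq_zero_of_smul.mpr fun a ha => ?_
    obtain ⟨u, rfl⟩ := Submodule.mkQ_surjective _ a
    rw [← map_smul] at ha
    exact (Submodule.Quotient.mk_eq_zero _).mpr (hH u ((Submodule.Quotient.mk_eq_zero _).mp ha))
  -- For large n, ℓ(N / m N) = e forces ℓ(m N / F_{n+1}) = ℓ(N / F_n), the equality needed for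
  -- division by x.
  obtain ⟨q, hq, hdiv⟩ : ∃ q : R[X], q ∉ (maximalIdeal R).map C ∧ ∀ u : PolynomialModule R N,
      (∀ i, u.coeff i ∈ (maximalIdeal R • ⊤ : Submodule R N)) → ∃ v, q • u = x • v := by
    obtain ⟨e₁, he₁, ⟨n₀, hn₀⟩, -⟩ := exists_hasMult N hy hy'
    obtain rfl := he.unique he₁
    obtain ⟨c, hc⟩ := exists_satPow_add_le _ hy hregN
    have h2 : satPow N (maximalIdeal R) (n₀ + c + 1 + 1) ≤ maximalIdeal R ^ 2 • ⊤ :=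
      (satPow_antitone _ (by omega)).trans (hc 2)
    obtain ⟨L, hL⟩ := ENat.ne_top_iff_exists.mp
      (length_quotient_satPow_ne_top (N := N) hy hy' (n₀ + c + 1))
    refine hx.exists_smul_eq h2 hL.symm ?_
    have h3 := length_quotient_eq_add (A := (maximalIdeal R • ⊤ : Submodule R N))
      (h2.trans (Submodule.smul_mono_left (Ideal.pow_le_self two_ne_zero)))
    rw [hn₀ _ (by omega), hN, ← hL, add_comm] at h3
    refine le_antisymm ?_ ?_ <;>
      exact (ENat.add_le_add_iff_right (ENat.natCast_ne_top _)).mp (by rw [h3])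
  obtain ⟨e₁, he₁, ⟨n₀, hn₀⟩, -⟩ := exists_hasMult H hy hy'
  obtain rfl := he'.unique he₁
  obtain ⟨c, hc⟩ := exists_satPow_add_le (N := H) _ hy hregH
  -- For u in m H[T], q u = x v is solved in each component of N^g; x is regular on the
  -- y-torsion-free quotient N^g / H, so v lies in H[T]. This reverses the usual inequality of
  -- lengths.
  have hrel : relLength (maximalIdeal R • ⊤) (satPow H (maximalIdeal R) (n₀ + c + 1)) ≤
      relLength ⊤ (satPow H (maximalIdeal R) (n₀ + c)) := by
    refine relLength_le_of_relation (smulRelation H q x) q.natDegree ?_ ?_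
    · intro p u hu hp
      have hcomp : ∀ j : Fin g, ∃ v : PolynomialModule R N,
          q • mapCoeff (LinearMap.proj j ∘ₗ H.subtype) u = x • v := by
        refine fun j => hdiv _ fun i => ?_
        have hle : (maximalIdeal R • ⊤ : Submodule R H) ≤
            (maximalIdeal R • ⊤ : Submodule R N).comap (LinearMap.proj j ∘ₗ H.subtype) := by
          rw [← Submodule.map_le_iff_le_comap, Submodule.map_smul'']
          exact smul_mono_right _ le_top
        exact hle (hu i)
      choose v hv using hcomp
      let V : PolynomialModule R (Fin g → N) :=
        ∑ j, mapCoeff (LinearMap.single R (fun _ => N) j) (v j)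
      have hVc : ∀ k j, V.coeff k j = (v j).coeff k := by
        intro k j
        rw [PolynomialModule.coeff_sum, Finsupp.finsetSum_apply, Finset.sum_apply]
        simp [coeff_mapCoeff, Pi.single_apply]
      have hV : x • V = q • mapCoeff H.subtype u := by
        refine coeff_ext fun k => funext fun j => ?_
        have := congrArg (fun w => w.coeff k) (hv j)
        simp only [PolynomialModule.smul_apply, coeff_mapCoeff, Finset.sum_apply, Pi.smul_apply,
          hVc] at this ⊢
        exact this.symm
      have hVH : ∀ k, V.coeff k ∈ H := by
        have h0 : x • mapCoeff H.mkQ V = 0 := by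
          rw [← mapCoeff_smul, hV, mapCoeff_smul]
          have : mapCoeff H.mkQ (mapCoeff H.subtype u) = 0 :=
            coeff_ext fun k => (Submodule.Quotient.mk_eq_zero H).mpr (u.coeff k).2
          rw [this, smul_zero]
        have h1 := hx.eq_zero_of_smul_eq_zero hregQ h0
        intro k
        exact (Submodule.Quotient.mk_eq_zero H).mp (congrArg (fun w => w.coeff k) h1)
      obtain ⟨v', hv'⟩ := exists_mapCoeff_subtype_eq hVH
      have heq : q • u = x • v' := by
        refine coeff_ext fun k => Subtype.ext ?_
        have := congrArg (fun w => w.coeff k) hV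
        rw [← hv', ← mapCoeff_smul, ← mapCoeff_smul] at this
        exact this.symm
      refine ⟨v', heq, fun _ => trivial, ?_⟩
      refine coeff_eq_zero_of_smul_coeff_eq_zero (x := x) (hx.leading ▸ hregH) fun i hi => ?_
      rw [← heq]
      exact coeff_smul_eq_zero le_rfl hp hi
    · intro u v huv _ hv
      have huv : q • u = x • v := huv
      refine coeff_mem_of_unit_smul_coeff_mem hq (pow_smul_top_le_satPow _ _) fun i => ?_
      rw [huv]
      exact smul_satPow_le _ _ (coeff_smul_mem hx.coeff_mem hv i)
  have hle : satPow H (maximalIdeal R) (n₀ + c + 1) ≤ maximalIdeal R • ⊤ := by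
    have := hc 1
    rw [pow_one] at this
    exact (satPow_antitone _ (by omega)).trans this
  have h1 := length_quotient_eq_add hle
  rw [hn₀ _ (by omega)] at h1
  rw [relLength_top] at hrel
  have h2 := add_le_add_left hrel (Module.length R (H ⧸ (maximalIdeal R • ⊤ : Submodule R H)))
  rw [← h1, add_comm] at h2
  exact (ENat.add_le_add_iff_left (length_quotient_satPow_ne_top (N := H) hy hy' _)).mp h2

end TorsionFreeQuotient

/-! ### Modules that are free up to a non-zero-divisor. -/

section QuasiFree

variable {R : Type*} [CommRing R] {N : Type*} [AddCommGroup N] [Module R N]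

variable (R N) in
/-- `N` is isomorphic to `R ^ r` up to multiplication by a non-zero-divisor `z`. -/
def IsQuasiFree (r : ℕ) : Prop :=
  ∃ z ∈ nonZeroDivisors R, ∃ (f : (Fin r → R) →ₗ[R] N) (g : N →ₗ[R] (Fin r → R)),
    (∀ w, f (g w) = z • w) ∧ ∀ v, g (f v) = z • v

theorem IsQuasiFree.of_equiv {L : Type*} [AddCommGroup L] [Module R L] {r : ℕ}
    (e : L ≃ₗ[R] (Fin r → R)) {z : R} (hz : z ∈ nonZeroDivisors R) (f : L →ₗ[R] N) (g : N →ₗ[R] L)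
    (hfg : ∀ w, f (g w) = z • w) (hgf : ∀ v, g (f v) = z • v) : IsQuasiFree R N r :=
  ⟨z, hz, f ∘ₗ e.symm.toLinearMap, e.toLinearMap ∘ₗ g, fun w => by simp [hfg],
    fun v => by simp [hgf]⟩

theorem IsQuasiFree.dual {r : ℕ} (h : IsQuasiFree R N r) : IsQuasiFree R (Module.Dual R N) r := by
  obtain ⟨z, hz, f, g, hfg, hgf⟩ := h
  refine .of_equiv (Pi.basisFun R (Fin r)).toDualEquiv.symm hz g.dualMap f.dualMap
    (fun l => ?_) fun l => ?_
  · ext w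
    simp [hfg]
  · ext w
    simp [hgf]

theorem IsQuasiFree.tensor [Nontrivial R] {N' : Type*} [AddCommGroup N'] [Module R N'] {r s : ℕ}
    (h : IsQuasiFree R N r) (h' : IsQuasiFree R N' s) : IsQuasiFree R (N ⊗[R] N') (r * s) := by
  obtain ⟨z, hz, f, g, hfg, hgf⟩ := h
  obtain ⟨z', hz', f', g', hfg', hgf'⟩ := h'
  refine .of_equiv (L := (Fin r → R) ⊗[R] (Fin s → R)) (LinearEquiv.ofFinrankEq _ _ (by simp))
    (mul_mem hz hz') (TensorProduct.map f f') (TensorProduct.map g g') (fun w => ?_) fun w => ?_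
  · induction w with
    | zero => simp
    | tmul a b =>
      rw [TensorProduct.map_tmul, TensorProduct.map_tmul, hfg, hfg', TensorProduct.smul_tmul_smul]
    | add a b ha hb => rw [map_add, map_add, ha, hb, smul_add]
  · induction w with
    | zero => simp
    | tmul a b =>
      rw [TensorProduct.map_tmul, TensorProduct.map_tmul, hgf, hgf', TensorProduct.smul_tmul_smul]
    | add a b ha hb => rw [map_add, map_add, ha, hb, smul_add]

theorem isQuasiFree_one_of_mem {I : Ideal R} {y : R} (hy : y ∈ I) (hy' : y ∈ nonZeroDivisors R) :
    IsQuasiFree R I 1 := by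
  refine .of_equiv (LinearEquiv.funUnique (Fin 1) R R).symm hy'
    (LinearMap.toSpanSingleton R I ⟨y, hy⟩) I.subtype (fun w => Subtype.ext ?_) fun v => ?_
  · simp [mul_comm]
  · simp [mul_comm]

theorem IsQuasiFree.hasMult [IsNoetherianRing R] [Ring.KrullDimLE 1 R] [Module.Finite R N]
    {r : ℕ} (h : IsQuasiFree R N r) {I : Ideal R} {e : ℕ} (he : HasMult R I e) :
    HasMult N I (r * e) := by
  obtain ⟨z, hz, f, g, hfg, hgf⟩ := h
  exact (he.pi r).of_quasi hz f g hfg hgf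

/-- Lifting gives θ η = z, so det θ divides a power of z and is a non-zero-divisor; the adjugate
then shows injectivity. -/
theorem injective_of_smul_mem_range {n : ℕ} {θ : (Fin n → R) →ₗ[R] (Fin n → R)} {z : R}
    (hz : z ∈ nonZeroDivisors R) (h : ∀ v, z • v ∈ LinearMap.range θ) : Function.Injective θ := by
  obtain ⟨η, hη⟩ := Module.projective_lifting_property θ.rangeRestrict
    ((LinearMap.lsmul R (Fin n → R) z).codRestrict _ h) θ.surjective_rangeRestrict
  have hcomp : θ ∘ₗ η = z • LinearMap.id :=
    LinearMap.ext fun v => congrArg Subtype.val (LinearMap.congr_fun hη v)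
  have hdet : LinearMap.det θ * LinearMap.det η = z ^ Module.finrank R (Fin n → R) := by
    rw [← LinearMap.det_comp, hcomp, LinearMap.det_smul, LinearMap.det_id, mul_one]
  have hreg : LinearMap.det θ ∈ nonZeroDivisors R :=
    (mul_mem_nonZeroDivisors.mp (hdet ▸ pow_mem hz _)).1
  rw [← LinearMap.ker_eq_bot, LinearMap.ker_eq_bot']
  intro v hv
  have hm : (LinearMap.toMatrix' θ).mulVec v = 0 := by rw [LinearMap.toMatrix'_mulVec, hv]
  rw [← LinearMap.det_toMatrix'] at hreg
  have h1 : (LinearMap.toMatrix' θ).det • v = 0 := by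
    rw [← Matrix.one_mulVec v, ← Matrix.smul_mulVec, ← Matrix.adjugate_mul, ← Matrix.mulVec_mulVec,
      hm, Matrix.mulVec_zero]
  ext i
  exact (mul_right_mem_nonZeroDivisors_eq_zero_iff hreg).mp
    (by simpa [mul_comm] using congrFun h1 i)

/-- A surjection from R^r to `N` followed by g has image containing z R^r, hence is injective. -/
theorem IsQuasiFree.nonempty_equiv [Module.Finite R N] {r : ℕ} (h : IsQuasiFree R N r)
    (hr : (⊤ : Submodule R N).spanFinrank ≤ r) : Nonempty (N ≃ₗ[R] (Fin r → R)) := by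
  obtain ⟨z, hz, f, g, hfg, hgf⟩ := h
  obtain ⟨s, hcard, hs⟩ := Submodule.FG.exists_span_finset_card_eq_spanFinrank
    (Module.Finite.fg_top (R := R) (M := N))
  obtain ⟨π, hπ⟩ : ∃ π : (Fin r → R) →ₗ[R] N, Function.Surjective π := by
    -- There may be fewer than r generators; the list is padded with zeros.
    let ι : s ↪ Fin r := s.equivFin.toEmbedding.trans (Fin.castLEEmb (hcard ▸ hr))
    refine ⟨Fintype.linearCombination R fun i : Fin r =>
      if h : ∃ a, ι a = i then ((h.choose : s) : N) else 0, ?_⟩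
    rw [← LinearMap.range_eq_top, Fintype.range_linearCombination, eq_top_iff, ← hs,
      Submodule.span_le]
    intro a ha
    refine Submodule.subset_span ⟨ι ⟨a, ha⟩, ?_⟩
    have hex : ∃ b, ι b = ι ⟨a, ha⟩ := ⟨_, rfl⟩
    dsimp only
    rw [dif_pos hex, ι.injective hex.choose_spec]
  have hinj : Function.Injective (g ∘ₗ π) := by
    refine injective_of_smul_mem_range hz fun v => ?_
    obtain ⟨w, hw⟩ := hπ (f v)
    exact ⟨w, by rw [LinearMap.comp_apply, hw, hgf]⟩
  exact ⟨(LinearEquiv.ofBijective π ⟨fun a b hab => hinj (congrArg g hab), hπ⟩).symm⟩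

end QuasiFree

/-! ### Numbers of generators as dimensions over the residue field. -/

section NumberOfGenerators

variable {R : Type*} [CommRing R] [IsLocalRing R] (N : Type*) [AddCommGroup N] [Module R N]
  [Module.Finite R N]

theorem finrank_residueField_tensor :
    Module.finrank (ResidueField R) (ResidueField R ⊗[R] N) =
      (⊤ : Submodule R N).spanFinrank := by
  rw [← TensorProduct.spanFinrank_top_eq_of_residueField _ (Module.Finite.fg_top (R := R) (M := N)),
    ← Module.finrank_eq_spanFinrank_of_free]
  exact (TensorProduct.AlgebraTensorModule.congr (LinearEquiv.refl (ResidueField R) _)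
    (Submodule.topEquiv (R := R) (M := N)).symm).finrank_eq

theorem length_quotient_maximalIdeal :
    Module.length R (N ⧸ (maximalIdeal R • ⊤ : Submodule R N)) =
      (⊤ : Submodule R N).spanFinrank := by
  rw [← finrank_residueField_tensor N, ← Module.length_eq_finrank (ResidueField R),
    ← Module.length_eq_of_surjective (S := R) (R := ResidueField R) residue_surjective]
  exact (TensorProduct.quotTensorEquivQuotSMul N (maximalIdeal R)).symm.length_eq

theorem spanFinrank_tensor (N' : Type*) [AddCommGroup N'] [Module R N'] [Module.Finite R N'] :
    (⊤ : Submodule R (N ⊗[R] N')).spanFinrank =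
      (⊤ : Submodule R N).spanFinrank * (⊤ : Submodule R N').spanFinrank := by
  rw [← finrank_residueField_tensor, ← finrank_residueField_tensor, ← finrank_residueField_tensor,
    ← Module.finrank_tensorProduct]
  exact (TensorProduct.AlgebraTensorModule.distribBaseChange R (ResidueField R) N N').finrank_eq

end NumberOfGenerators

/-! ### From rank at the associated primes to quasi-freeness. -/

section HasRank

variable {R : Type*} [CommRing R] {M : Type*} [AddCommGroup M] [Module R M]

/-- If `M` is free of rank `r` at the prime `p`, then so is its base change to any `R`-algebra in
which the elements outside `p` are invertible. -/
theorem nonempty_baseChange_equiv {p : Ideal R} [p.IsPrime] {r : ℕ}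
    (h : Nonempty (LocalizedModule p.primeCompl M ≃ₗ[Localization.AtPrime p]
      (Fin r → Localization.AtPrime p)))
    (A : Type*) [CommRing A] [Algebra R A] (hA : ∀ a ∉ p, IsUnit (algebraMap R A a)) :
    Nonempty (A ⊗[R] M ≃ₗ[A] (Fin r → A)) := by
  obtain ⟨e⟩ := h
  let Rp := Localization.AtPrime p
  let φ : Rp →+* A := IsLocalization.lift (M := p.primeCompl) (g := algebraMap R A) fun a => hA a a.2
  let : Algebra Rp A := φ.toAlgebra
  have : IsScalarTower R Rp A := IsScalarTower.of_algebraMap_eq fun a =>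
    (IsLocalization.lift_eq (M := p.primeCompl) (fun a => hA a a.2) a).symm
  have e₁ : Rp ⊗[R] M ≃ₗ[Rp] LocalizedModule p.primeCompl M :=
    ((isLocalizedModule_iff_isBaseChange p.primeCompl Rp
      (LocalizedModule.mkLinearMap p.primeCompl M)).mp inferInstance).equiv
  have e₂ : A ⊗[R] M ≃ₗ[A] A ⊗[Rp] (Rp ⊗[R] M) :=
    (TensorProduct.AlgebraTensorModule.cancelBaseChange R Rp A A M).symm
  have e₃ : A ⊗[Rp] (Rp ⊗[R] M) ≃ₗ[A] A ⊗[Rp] (Fin r → Rp) :=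
    TensorProduct.AlgebraTensorModule.congr (LinearEquiv.refl A A) (e₁ ≪≫ₗ e)
  exact ⟨e₂ ≪≫ₗ e₃ ≪≫ₗ TensorProduct.piScalarRight Rp A A (Fin r)⟩

/-- Maximal ideals of the total ring of fractions contract to associated primes of `R`. Over this
semilocal ring a finite flat module of constant rank is free. -/
theorem HasRankOn.nonempty_equiv [IsNoetherianRing R] [Module.Finite R M] {r : ℕ}
    (h : HasRankOn R M {p : PrimeSpectrum R | p.asIdeal ∈ associatedPrimes R R} r) :
    Nonempty (FractionRing R ⊗[R] M ≃ₗ[FractionRing R] (Fin r → FractionRing R)) := by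
  let Q := FractionRing R
  have key : ∀ (P : Ideal Q) [P.IsMaximal] (A : Type _) [CommRing A] [Algebra R A] [Algebra Q A]
      [IsScalarTower R Q A], (∀ a ∉ P, IsUnit (algebraMap Q A a)) →
      Nonempty (A ⊗[Q] (Q ⊗[R] M) ≃ₗ[A] (Fin r → A)) := by
    intro P hP A _ _ _ _ hA
    have hmem : P.comap (algebraMap R Q) ∈ associatedPrimes R R :=
      Module.associatedPrimes.comap_mem_associatedPrimes_of_mem_associatedPrimes_of_isLocalizedModule_of_fg
        (nonZeroDivisors R) (Algebra.linearMap R Q) P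
        hP.mem_associatedPrimes_of_isFractionRing (IsNoetherian.noetherian _)
    have hp : (P.comap (algebraMap R Q)).IsPrime := inferInstance
    obtain ⟨e⟩ := nonempty_baseChange_equiv (h ⟨_, hp⟩ hmem) A fun a ha => by
      rw [IsScalarTower.algebraMap_apply R Q A]
      exact hA _ ha
    exact ⟨TensorProduct.AlgebraTensorModule.cancelBaseChange R Q A A M ≪≫ₗ e⟩
  have hflat : Module.Flat Q (Q ⊗[R] M) := by
    refine Module.flat_of_isLocalized_maximal Q (Q ⊗[R] M)
      (fun P _ => Localization.AtPrime P ⊗[Q] (Q ⊗[R] M))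
      (fun P _ => TensorProduct.mk Q (Localization.AtPrime P) (Q ⊗[R] M) 1) fun P hP => ?_
    obtain ⟨e⟩ := key P (Localization.AtPrime P) fun a ha =>
      IsLocalization.map_units (M := P.primeCompl) (Localization.AtPrime P) ⟨a, ha⟩
    have : Module.Flat Q (Fin r → Localization.AtPrime P) :=
      Module.Flat.trans Q (Localization.AtPrime P) _
    exact Module.Flat.of_linearEquiv (e.restrictScalars Q)
  obtain ⟨b⟩ := Module.nonempty_basis_of_flat_of_finrank_eq Q (Q ⊗[R] M) r fun P => by
    have hP := P.2
    let := Ideal.Quotient.field P.1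
    obtain ⟨e⟩ := key P.1 (Q ⧸ P.1) fun a ha => by
      rw [isUnit_iff_ne_zero]
      exact fun h0 => ha (Ideal.Quotient.eq_zero_iff_mem.mp h0)
    rw [e.finrank_eq]
    simp
  exact ⟨b.equivFun⟩

/-- Denominators are cleared in the isomorphism and in its inverse; torsion-freeness embeds `M` in
its localisation. -/
theorem isQuasiFree_of_nonempty_equiv [IsNoetherianRing R] [Module.Finite R M]
    [Module.IsTorsionFree R M] {r : ℕ}
    (h : Nonempty (FractionRing R ⊗[R] M ≃ₗ[FractionRing R] (Fin r → FractionRing R))) :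
    IsQuasiFree R M r := by
  obtain ⟨e⟩ := h
  let S := nonZeroDivisors R
  let Q := FractionRing R
  let i : M →ₗ[R] Q ⊗[R] M := TensorProduct.mk R Q M 1
  have hi : IsLocalizedModule S i :=
    (isLocalizedModule_iff_isBaseChange S Q i).mpr (TensorProduct.isBaseChange R M Q)
  let j : (Fin r → R) →ₗ[R] (Fin r → Q) := LinearMap.pi fun k => Algebra.linearMap R Q ∘ₗ LinearMap.proj k
  have hj : IsLocalizedModule S j := inferInstance
  have hjinj : Function.Injective j := fun a b hab =>
    funext fun k => IsFractionRing.injective R Q (congrFun hab k)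
  have hiinj : Function.Injective i := by
    intro a b hab
    obtain ⟨s, hs⟩ := (IsLocalizedModule.eq_iff_exists S i).mp hab
    exact isSMulRegular_of_mem_nonZeroDivisors s.2 hs
  have hfp : Module.FinitePresentation R M := Module.finitePresentation_of_finite R M
  obtain ⟨g, s, hg⟩ := Module.FinitePresentation.exists_lift_of_isLocalizedModule S j
    (e.toLinearMap.restrictScalars R ∘ₗ i)
  obtain ⟨f, t, hf⟩ := Module.FinitePresentation.exists_lift_of_isLocalizedModule S i
    (e.symm.toLinearMap.restrictScalars R ∘ₗ j)
  have hg' : ∀ w, j (g w) = (s : R) • e (i w) := fun w => LinearMap.congr_fun hg w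
  have hf' : ∀ v, i (f v) = (t : R) • e.symm (j v) := fun v => LinearMap.congr_fun hf v
  have he : ∀ (a : R) x, e (a • x) = a • e x := (e.toLinearMap.restrictScalars R).map_smul
  have he' : ∀ (a : R) x, e.symm (a • x) = a • e.symm x :=
    (e.symm.toLinearMap.restrictScalars R).map_smul
  refine ⟨s * t, mul_mem s.2 t.2, f, g, fun w => hiinj ?_, fun v => hjinj ?_⟩
  · rw [hf', hg', he', e.symm_apply_apply, smul_smul, map_smul, mul_comm]
  · rw [hg', hf', he, e.apply_symm_apply, smul_smul, map_smul]

theorem HasRankOn.isQuasiFree [IsNoetherianRing R] [Module.Finite R M] [Module.IsTorsionFree R M]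
    {r : ℕ} (h : HasRankOn R M {p : PrimeSpectrum R | p.asIdeal ∈ associatedPrimes R R} r) :
    IsQuasiFree R M r :=
  isQuasiFree_of_nonempty_equiv h.nonempty_equiv

theorem exists_isQuasiFree_of_isDomain [IsDomain R] [IsNoetherianRing R] [Module.Finite R M]
    [Module.IsTorsionFree R M] : ∃ r, IsQuasiFree R M r :=
  ⟨_, isQuasiFree_of_nonempty_equiv
    ⟨(Module.finBasis (FractionRing R) (FractionRing R ⊗[R] M)).equivFun⟩⟩

/-- Cancellation of a free summand of rank one after inverting the non-zero-divisors. -/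
theorem nonempty_equiv_of_prod [IsNoetherianRing R] {M' : Type*} [AddCommGroup M'] [Module R M']
    [Module.Finite R M'] (e : M ≃ₗ[R] R × M') {r : ℕ}
    (h : Nonempty (FractionRing R ⊗[R] M ≃ₗ[FractionRing R] (Fin (r + 1) → FractionRing R))) :
    Nonempty (FractionRing R ⊗[R] M' ≃ₗ[FractionRing R] (Fin r → FractionRing R)) := by
  obtain ⟨e'⟩ := h
  let Q := FractionRing R
  have ε : (Fin (r + 1) → Q) ≃ₗ[Q] Q × (Q ⊗[R] M') :=
    e'.symm ≪≫ₗ TensorProduct.AlgebraTensorModule.congr (LinearEquiv.refl Q Q) e ≪≫ₗ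
      TensorProduct.prodRight R Q Q R M' ≪≫ₗ
      LinearEquiv.prodCongr (TensorProduct.AlgebraTensorModule.rid R Q Q) (LinearEquiv.refl Q _)
  have hflat : Module.Flat Q (Q ⊗[R] M') := by
    have : Module.Flat Q (Q × (Q ⊗[R] M')) := Module.Flat.of_linearEquiv ε.symm
    exact Module.Flat.of_retract (LinearMap.inr Q Q (Q ⊗[R] M')) (LinearMap.snd Q Q (Q ⊗[R] M'))
      (LinearMap.snd_comp_inr _ _ _)
  obtain ⟨b⟩ := Module.nonempty_basis_of_flat_of_finrank_eq Q (Q ⊗[R] M') r fun P => by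
    have hP := P.2
    let := Ideal.Quotient.field P.1
    have ε' := TensorProduct.AlgebraTensorModule.congr (LinearEquiv.refl (Q ⧸ P.1) (Q ⧸ P.1)) ε ≪≫ₗ
      TensorProduct.prodRight Q (Q ⧸ P.1) (Q ⧸ P.1) Q (Q ⊗[R] M')
    have h := ε'.finrank_eq
    have h₁ : Module.finrank (Q ⧸ P.1) ((Q ⧸ P.1) ⊗[Q] Q) = 1 := by
      rw [(TensorProduct.AlgebraTensorModule.rid Q (Q ⧸ P.1) (Q ⧸ P.1)).finrank_eq,
        Module.finrank_self]
    have : Nontrivial Q :=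
      ⟨⟨0, 1, fun h01 => hP.ne_top ((Ideal.eq_top_iff_one _).mpr (h01 ▸ zero_mem P.1))⟩⟩
    have h₂ : Module.finrank (Q ⧸ P.1) ((Q ⧸ P.1) ⊗[Q] (Fin (r + 1) → Q)) = r + 1 := by
      rw [Module.finrank_baseChange, Module.finrank_fin_fun]
    rw [h₂, Module.finrank_prod, h₁] at h
    omega
  exact ⟨b.equivFun⟩

end HasRank

/-! ### Reflexivity when the dual is free. -/

section Bidual

variable {R : Type*} [CommRing R] {M : Type*} [AddCommGroup M] [Module R M]

theorem exists_eq_smul_of_forall_mem {z : R} (hz : z ∈ nonZeroDivisors R) {f : M →ₗ[R] R}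
    (h : ∀ w, f w ∈ Ideal.span {z}) : ∃ f' : M →ₗ[R] R, ∀ w, f w = z * f' w := by
  have hinj : Function.Injective (LinearMap.lsmul R R z) := fun a b hab =>
    (mul_cancel_left_mem_nonZeroDivisors hz).mp hab
  have hmem : ∀ w, f w ∈ LinearMap.range (LinearMap.lsmul R R z) := fun w => by
    obtain ⟨c, hc⟩ := Ideal.mem_span_singleton'.mp (h w)
    exact ⟨c, by simp [← hc, mul_comm]⟩
  refine ⟨(LinearEquiv.ofInjective _ hinj).symm.toLinearMap ∘ₗ f.codRestrict _ hmem, fun w => ?_⟩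
  have := (LinearEquiv.ofInjective _ hinj).apply_symm_apply (f.codRestrict _ hmem w)
  exact (congrArg Subtype.val this).symm

theorem IsQuasiFree.congr {N : Type*} [AddCommGroup N] [Module R N] {r : ℕ}
    (h : IsQuasiFree R M r) (e : M ≃ₗ[R] N) : IsQuasiFree R N r := by
  obtain ⟨z, hz, f, g, hfg, hgf⟩ := h
  exact ⟨z, hz, e.toLinearMap ∘ₗ f, g ∘ₗ e.symm.toLinearMap, fun w => by simp [hfg],
    fun v => by simp [hgf]⟩

variable [IsLocalRing R] [IsNoetherianRing R] [Ring.KrullDimLE 1 R]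

theorem exists_socle_element {z : R} (hz : z ∈ nonZeroDivisors R) (hz' : ¬ IsUnit z) :
    ∃ t : R, t ∉ Ideal.span {z} ∧ ∀ a ∈ maximalIdeal R, t * a ∈ Ideal.span {z} := by
  classical
  have hart : IsArtinian R (R ⧸ Ideal.span {z}) :=
    (isFiniteLength_iff_isNoetherian_isArtinian.mp (isFiniteLength_quotient_span_singleton R hz)).2
  have hart' : IsArtinianRing (R ⧸ Ideal.span {z}) := isArtinian_of_tower R hart
  have hex := IsLocalRing.exists_maximalIdeal_pow_le_of_isArtinianRing_quotient (Ideal.span {z})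
  have hne : Nat.find hex ≠ 0 := by
    intro h0
    have := Nat.find_spec hex
    rw [h0, pow_zero, Ideal.one_eq_top, top_le_iff, Ideal.span_singleton_eq_top] at this
    exact hz' this
  -- t lies in the last power of m not contained in z R.
  obtain ⟨t, ht, ht'⟩ := SetLike.not_le_iff_exists.mp (Nat.find_min hex (Nat.pred_lt hne))
  refine ⟨t, ht', fun a ha => Nat.find_spec hex ?_⟩
  rw [← Nat.succ_pred_eq_of_ne_zero hne, pow_succ]
  exact Ideal.mul_mem_mul ht ha

/-- A torsion-free module of constant rank over a one-dimensional local ring whose dual is free is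
reflexive. -/
theorem IsQuasiFree.bijective_eval [Module.IsTorsionFree R M] {r : ℕ} (h : IsQuasiFree R M r)
    [Module.Free R (Module.Dual R M)] [Module.Finite R (Module.Dual R M)] :
    Function.Bijective (Module.Dual.eval R M) := by
  obtain ⟨z, hz, f, g, hfg, hgf⟩ := h
  have hzM := isSMulRegular_of_mem_nonZeroDivisors (N := M) hz
  have hsmul : ∀ Φ : Module.Dual R (Module.Dual R M), ∃ m, Module.Dual.eval R M m = z • Φ := by
    intro Φ
    obtain ⟨v, hv⟩ := (Module.bijective_dual_eval R (Fin r → R)).2 (Φ ∘ₗ g.dualMap)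
    refine ⟨f v, LinearMap.ext fun l => ?_⟩
    have h1 := LinearMap.congr_fun hv (l ∘ₗ f)
    have h2 : g.dualMap (l ∘ₗ f) = z • l := LinearMap.ext fun w => by simp [hfg]
    rw [LinearMap.comp_apply, h2, map_smul] at h1
    exact h1
  constructor
  · rw [← LinearMap.ker_eq_bot, LinearMap.ker_eq_bot']
    intro m hm
    have hgm : g m = 0 := by
      ext i
      exact LinearMap.congr_fun hm (LinearMap.proj i ∘ₗ g)
    have h1 := hfg m
    rw [hgm, map_zero] at h1
    exact hzM (by simpa using h1.symm)
  · by_cases hzu : IsUnit z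
    · intro Φ
      obtain ⟨m, hm⟩ := hsmul Φ
      obtain ⟨c, hc⟩ := hzu.exists_left_inv
      exact ⟨c • m, by rw [map_smul, hm, smul_smul, hc, one_smul]⟩
    rw [← LinearMap.range_eq_top]
    by_contra hne
    obtain ⟨P, hP, hle⟩ := (eq_top_or_exists_le_coatom
      (LinearMap.range (Module.Dual.eval R M))).resolve_left hne
    obtain ⟨J, hJ, ⟨ε⟩⟩ := isSimpleModule_iff_quot_maximal.mp (isSimpleModule_iff_isCoatom.mpr hP)
    obtain rfl := IsLocalRing.eq_maximalIdeal hJ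
    -- If the image of `M` in M** is proper, freeness of M** yields a functional l that maps this
    -- image into m but has a unit value.
    obtain ⟨l, hl⟩ := Module.projective_lifting_property (maximalIdeal R).mkQ
      (ε.toLinearMap ∘ₗ P.mkQ) (Submodule.mkQ_surjective _)
    have hlm : ∀ m, l (Module.Dual.eval R M m) ∈ maximalIdeal R := by
      intro m
      rw [← Submodule.Quotient.mk_eq_zero (maximalIdeal R)]
      have h1 := LinearMap.congr_fun hl (Module.Dual.eval R M m)
      have h2 : P.mkQ (Module.Dual.eval R M m) = 0 :=
        (Submodule.Quotient.mk_eq_zero P).mpr (hle ⟨m, rfl⟩)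
      rw [LinearMap.comp_apply, LinearMap.comp_apply, h2, map_zero] at h1
      exact h1
    obtain ⟨t, ht, htm⟩ := exists_socle_element hz hzu
    -- Since t m ⊆ z R, on `M` the functional t l is z times some k in M*. The identity extends to
    -- M** because z M** lies in the image of `M`, and a unit value of l puts t in z R.
    obtain ⟨k, hk⟩ := exists_eq_smul_of_forall_mem hz
      (f := t • (l ∘ₗ Module.Dual.eval R M)) fun m => htm _ (hlm m)
    have hall : ∀ Φ, t * l Φ = z * Φ k := by
      intro Φ
      obtain ⟨m, hm⟩ := hsmul Φ
      have h1 : t * l (Module.Dual.eval R M m) = z * k m := hk m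
      have h2 : k m = z * Φ k := by
        have := LinearMap.congr_fun hm k
        exact this
      rw [hm, map_smul, h2, smul_eq_mul, mul_left_comm] at h1
      exact (mul_cancel_left_mem_nonZeroDivisors hz).mp h1
    obtain ⟨Φ, hΦ⟩ := (ε.surjective.comp (Submodule.mkQ_surjective P))
      ((maximalIdeal R).mkQ 1)
    have hunit : IsUnit (l Φ) := by
      by_contra hnot
      have h1 : (maximalIdeal R).mkQ (l Φ) = (maximalIdeal R).mkQ 1 :=
        (LinearMap.congr_fun hl Φ).trans hΦ
      have h2 : (maximalIdeal R).mkQ (l Φ) = 0 :=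
        (Submodule.Quotient.mk_eq_zero _).mpr ((mem_maximalIdeal _).mpr hnot)
      rw [h2] at h1
      exact (Ideal.ne_top_iff_one _).mp (maximalIdeal.isMaximal R).ne_top
        ((Submodule.Quotient.mk_eq_zero _).mp h1.symm)
    refine ht ((Ideal.mul_unit_mem_iff_mem _ hunit).mp ?_)
    rw [hall]
    exact Ideal.mul_mem_right _ _ (Ideal.mem_span_singleton_self z)

end Bidual

/-! ### Inequalities between generators, rank and multiplicity. -/

section Inequalities

variable {R : Type*} [CommRing R] [IsLocalRing R] [IsNoetherianRing R] [Ring.KrullDimLE 1 R]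
  {y : R} (hy : y ∈ maximalIdeal R) (hy' : y ∈ nonZeroDivisors R) {e : ℕ}
  (he : HasMult R (maximalIdeal R) e)
  {M : Type*} [AddCommGroup M] [Module R M] [Module.Finite R M]
include hy hy' he

theorem IsQuasiFree.spanFinrank_le [Module.IsTorsionFree R M] {r : ℕ} (h : IsQuasiFree R M r) :
    (⊤ : Submodule R M).spanFinrank ≤ r * e := by
  obtain ⟨e', he', -, hle⟩ := exists_hasMult M hy hy'
  rw [length_quotient_maximalIdeal, he'.unique (h.hasMult he)] at hle
  exact_mod_cast hle

theorem one_le_of_hasMult : 1 ≤ e := by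
  obtain ⟨e', he', -, hle⟩ := exists_hasMult R hy hy'
  rw [← he.unique he'] at hle
  have : Nontrivial (R ⧸ (maximalIdeal R • ⊤ : Submodule R R)) := by
    refine Submodule.Quotient.nontrivial_iff.mpr ?_
    rw [smul_eq_mul, Ideal.mul_top]
    exact (maximalIdeal.isMaximal R).ne_top
  have := Order.one_le_iff_pos.mpr (Module.length_pos (R := R)
    (M := R ⧸ (maximalIdeal R • ⊤ : Submodule R R)))
  exact_mod_cast this.trans hle

theorem IsQuasiFree.spanFinrank_mul_le {r : ℕ} (h : IsQuasiFree R M r)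
    [Module.IsTorsionFree R (M ⊗[R] Module.Dual R M)] :
    (⊤ : Submodule R M).spanFinrank * (⊤ : Submodule R (Module.Dual R M)).spanFinrank ≤
      r * r * e := by
  rw [← spanFinrank_tensor]
  exact (h.tensor h.dual).spanFinrank_le hy hy' he

/-- A torsion-free module of rank `r` with `r * e` generators such that `M ⊗ M*` is torsion-free
is free. -/
theorem IsQuasiFree.free_of_le_spanFinrank [Module.IsTorsionFree R M] {r : ℕ}
    (h : IsQuasiFree R M r) (hr : 0 < r) [Module.IsTorsionFree R (M ⊗[R] Module.Dual R M)]
    (hM : r * e ≤ (⊤ : Submodule R M).spanFinrank) : Module.Free R M := by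
  have h1 := h.spanFinrank_mul_le hy hy' he
  have h2 : r * e * (⊤ : Submodule R (Module.Dual R M)).spanFinrank ≤ r * e * r := by
    refine (Nat.mul_le_mul_right _ hM).trans (h1.trans (le_of_eq ?_))
    ring
  have h3 := Nat.le_of_mul_le_mul_left h2 (Nat.mul_pos hr (one_le_of_hasMult hy hy' he))
  obtain ⟨ε⟩ := h.dual.nonempty_equiv h3
  have hfree : Module.Free R (Module.Dual R M) := Module.Free.of_equiv ε.symm
  exact Module.Free.of_equiv (LinearEquiv.ofBijective _ h.bijective_eval).symm

theorem isRegularLocalRing_of_free [Nontrivial M] [Module.Free R M] {r : ℕ}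
    (h : IsQuasiFree R M r) (hM : r * e ≤ (⊤ : Submodule R M).spanFinrank)
    (hdim : ringKrullDim R = 1) : IsRegularLocalRing R := by
  have ε : M ≃ₗ[R] (Fin (Module.finrank R M) → R) := (Module.finBasis R M).equivFun
  have hq : IsQuasiFree R M (Module.finrank R M) :=
    .of_equiv ε (one_mem _) LinearMap.id LinearMap.id (by simp) (by simp)
  -- Uniqueness of the multiplicity replaces r e by rank · e, while μ(M) is the rank; so e ≤ 1.
  rw [(h.hasMult he).unique (hq.hasMult he), ← Module.finrank_eq_spanFinrank_of_free] at hM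
  have hpos : 0 < Module.finrank R M := by
    rw [Nat.pos_iff_ne_zero]
    intro h0
    rw [h0] at ε
    exact not_subsingleton M ε.toEquiv.subsingleton
  have he1 : e ≤ 1 := Nat.le_of_mul_le_mul_left (by rwa [mul_one]) hpos
  have hm := (isQuasiFree_one_of_mem hy hy').spanFinrank_le hy hy' he
  rw [one_mul, Submodule.spanFinrank_top] at hm
  refine IsRegularLocalRing.of_spanFinrank_maximalIdeal_le R ?_
  rw [hdim]
  exact_mod_cast hm.trans he1

/-- If every functional on `M` takes values in the maximal ideal `m` and `m` is generated by `e`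
elements, then the dual of `M` has the maximal number of generators. -/
theorem IsQuasiFree.le_spanFinrank_dual {r : ℕ} (h : IsQuasiFree R M r)
    (hm : (maximalIdeal R).spanFinrank = e)
    (hval : ∀ (f : Module.Dual R M) (w : M), f w ∈ maximalIdeal R) :
    r * e ≤ (⊤ : Submodule R (Module.Dual R M)).spanFinrank := by
  obtain ⟨n, π, hπ⟩ := Module.Finite.exists_fin' R M
  let s : Fin n → M := fun i => π (Pi.single i 1)
  have hs : ∀ {P : Submodule R M}, (∀ i, s i ∈ P) → P = ⊤ := by
    intro P hP
    rw [eq_top_iff, ← LinearMap.range_eq_top.mpr hπ]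
    rintro _ ⟨v, rfl⟩
    rw [pi_eq_sum_univ' v, map_sum]
    refine Submodule.sum_mem _ fun i _ => ?_
    rw [map_smul]
    exact Submodule.smul_mem _ _ (hP i)
  let Θ : Module.Dual R M →ₗ[R] (Fin n → maximalIdeal R) :=
    LinearMap.pi fun i => LinearMap.codRestrict _ (LinearMap.applyₗ (s i)) fun f => hval f _
  have hΘ : ∀ f i, ((Θ f i : maximalIdeal R) : R) = f (s i) := fun _ _ => rfl
  have hinj : Function.Injective Θ := by
    rw [← LinearMap.ker_eq_bot, LinearMap.ker_eq_bot']
    intro f hf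
    rw [← LinearMap.ker_eq_top]
    refine hs fun i => ?_
    rw [LinearMap.mem_ker, ← hΘ, hf]
    rfl
  let ε := LinearEquiv.ofInjective Θ hinj
  -- A functional with values in y R is y times another functional, which takes values in m again by
  -- `hval`.
  have hsat : ∀ u : Fin n → maximalIdeal R, y • u ∈ LinearMap.range Θ → u ∈ LinearMap.range Θ := by
    rintro u ⟨f, hf⟩
    have hfs : ∀ i, f (s i) = y * u i := fun i => by
      rw [← hΘ, hf]
      rfl
    have hf' : ∀ w, f w ∈ Ideal.span {y} := by
      have : Submodule.comap f (Ideal.span {y}) = ⊤ := hs fun i => by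
        rw [Submodule.mem_comap, hfs]
        exact Ideal.mul_mem_right _ _ (Ideal.mem_span_singleton_self y)
      exact fun w => (this ▸ Submodule.mem_top : w ∈ Submodule.comap f (Ideal.span {y}))
    obtain ⟨f', hf''⟩ := exists_eq_smul_of_forall_mem hy' hf'
    refine ⟨f', funext fun i => Subtype.ext ?_⟩
    rw [hΘ]
    refine (mul_cancel_left_mem_nonZeroDivisors hy').mp ?_
    rw [← hf'', hfs]
  have hmult : HasMult (maximalIdeal R) (maximalIdeal R) e := by
    have := (isQuasiFree_one_of_mem hy hy').hasMult he
    rwa [one_mul] at this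
  have hlen := le_length_of_torsionFree_quotient hy hy' hmult
    (by rw [length_quotient_maximalIdeal, Submodule.spanFinrank_top, hm]) _ hsat
    ((h.dual.congr ε).hasMult he)
  rw [length_quotient_maximalIdeal, ← finrank_residueField_tensor] at hlen
  rw [← finrank_residueField_tensor, (TensorProduct.AlgebraTensorModule.congr
    (LinearEquiv.refl (ResidueField R) (ResidueField R)) ε).finrank_eq]
  exact_mod_cast hlen

end Inequalities

/-! ### The two cases of the theorem. -/

section Main

variable {R : Type u} [CommRing R] [IsLocalRing R] [IsNoetherianRing R]

omit [IsNoetherianRing R] in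
theorem exists_mem_nonZeroDivisors_of_isCohenMacaulay (hCM : IsCohenMacaulay R R)
    (hdim : ringKrullDim R = 1) : ∃ y ∈ maximalIdeal R, y ∈ nonZeroDivisors R := by
  have hdepth : (depth R R : WithBot ℕ∞) = 1 := by
    rw [← hdim, ← Module.supportDim_self_eq_ringKrullDim]
    exact hCM.resolve_left (not_subsingleton R)
  have hdepth' : depth R R = 1 := by exact_mod_cast hdepth
  by_contra! hcon
  have h0 : depth R R = 0 := by
    rw [depth, ENat.iSup_eq_zero]
    rintro ⟨l, hl, hreg⟩
    cases l with
    | nil => rfl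
    | cons y l =>
      refine absurd ?_ (hcon y (hl y List.mem_cons_self))
      have := ((RingTheory.Sequence.isRegular_cons_iff R y l).mp hreg).1
      exact mem_nonZeroDivisors_iff_right.mpr fun a ha =>
        this (by simpa [mul_comm] using ha)
  rw [h0] at hdepth'
  exact zero_ne_one hdepth'

variable {M : Type v} [AddCommGroup M] [Module R M] [Module.Finite R M]

theorem dim_eq_one [Module.IsTorsionFree R M] [Nontrivial M] (hdim : ringKrullDim R = 1) {y : R}
    (hy : y ∈ maximalIdeal R) (hy' : y ∈ nonZeroDivisors R) : dim R M = 1 := by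
  have h1 := Module.supportDim_quotSMulTop_succ_eq_supportDim
    (isSMulRegular_of_mem_nonZeroDivisors (N := M) hy') hy
  have h2 : Module.supportDim R M ≤ 1 := hdim ▸ Module.supportDim_le_ringKrullDim R M
  have h3 : 1 ≤ Module.supportDim R M := by
    have hne := Module.supportDim_ne_bot_of_nontrivial R M
    rw [← h1] at hne ⊢
    generalize Module.supportDim R (QuotSMulTop y M) = d at hne ⊢
    cases d with
    | bot => exact absurd rfl hne
    | coe d =>
      norm_cast
      exact le_add_self
  rw [dim, le_antisymm h2 h3]
  rfl

omit [IsLocalRing R] [IsNoetherianRing R] [Module.Finite R M] in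
theorem exists_equiv_prod_ker {f : Module.Dual R M} {w : M} (hw : f w = 1) :
    Nonempty (M ≃ₗ[R] R × LinearMap.ker f) := by
  let q : M →ₗ[R] LinearMap.ker f :=
    (LinearMap.id - f.smulRight w).codRestrict _ fun v => by simp [hw]
  have hq : ∀ v, (q v : M) = v - f v • w := fun _ => rfl
  refine ⟨LinearEquiv.ofLinearMap (f.prod q)
    ((LinearMap.toSpanSingleton R M w).coprod (LinearMap.ker f).subtype) ?_ ?_⟩
  · refine LinearMap.ext fun ⟨a, k⟩ => Prod.ext ?_ (Subtype.ext ?_)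
    · simp [hw]
    · simp [hw, hq]
  · ext v
    simp [hq]

omit [IsLocalRing R] [IsNoetherianRing R] [Module.Finite R M] in
theorem isTorsionFree_tensor_dual_of_retract {M' : Type*} [AddCommGroup M'] [Module R M']
    [Module.IsTorsionFree R (M ⊗[R] Module.Dual R M)] (i : M' →ₗ[R] M) (p : M →ₗ[R] M')
    (h : p ∘ₗ i = LinearMap.id) : Module.IsTorsionFree R (M' ⊗[R] Module.Dual R M') := by
  have hinj : Function.Injective (TensorProduct.map i p.dualMap) := by
    refine Function.LeftInverse.injective (g := TensorProduct.map p i.dualMap) fun t => ?_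
    have hdual : i.dualMap ∘ₗ p.dualMap = LinearMap.id :=
      LinearMap.ext fun l => LinearMap.ext fun x => congrArg l (LinearMap.congr_fun h x)
    rw [← LinearMap.comp_apply, ← TensorProduct.map_comp, h, hdual, TensorProduct.map_id,
      LinearMap.id_apply]
  exact hinj.moduleIsTorsionFree _ fun r m => map_smul _ r m

omit [IsLocalRing R] [IsNoetherianRing R] [Module.Finite R M] in
theorem subsingleton_of_isQuasiFree_zero [Module.IsTorsionFree R M] (h : IsQuasiFree R M 0) :
    Subsingleton M := by
  obtain ⟨z, hz, f, g, hfg, -⟩ := h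
  refine subsingleton_of_forall_eq 0 fun m => isSMulRegular_of_mem_nonZeroDivisors (N := M) hz ?_
  change z • m = z • (0 : M)
  rw [← hfg, Subsingleton.elim (g m) 0, map_zero, smul_zero]

/-- Over a one-dimensional ring of minimal multiplicity a torsion-free module `M` with rank such
that `M ⊗ M*` is torsion-free is free. -/
theorem free_of_minimal_multiplicity [Ring.KrullDimLE 1 R] {y : R} (hy : y ∈ maximalIdeal R)
    (hy' : y ∈ nonZeroDivisors R) {e : ℕ} (he : HasMult R (maximalIdeal R) e)
    (hm : (maximalIdeal R).spanFinrank = e) (r : ℕ) :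
    ∀ (M : Type v) [AddCommGroup M] [Module R M] [Module.Finite R M] [Module.IsTorsionFree R M]
      [Module.IsTorsionFree R (M ⊗[R] Module.Dual R M)],
      Nonempty (FractionRing R ⊗[R] M ≃ₗ[FractionRing R] (Fin r → FractionRing R)) →
      Module.Free R M := by
  induction r with
  | zero =>
    intro M _ _ _ _ _ h
    have := subsingleton_of_isQuasiFree_zero (isQuasiFree_of_nonempty_equiv h)
    infer_instance
  | succ r ih =>
    intro M _ _ _ _ _ h
    have hq := isQuasiFree_of_nonempty_equiv h
    -- A functional with a unit value splits off a free summand of rank one and lowers the rank;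
    -- otherwise M* = Hom(M, m).
    by_cases hval : ∀ (f : Module.Dual R M) (w : M), f w ∈ maximalIdeal R
    · have h1 := hq.le_spanFinrank_dual hy hy' he hm hval
      have h2 := hq.spanFinrank_mul_le hy hy' he
      have h3 : (r + 1) * e * (⊤ : Submodule R M).spanFinrank ≤ (r + 1) * e * (r + 1) := by
        rw [mul_comm]
        refine (Nat.mul_le_mul_left _ h1).trans (h2.trans (le_of_eq ?_))
        ring
      obtain ⟨ε⟩ := hq.nonempty_equiv (Nat.le_of_mul_le_mul_left h3
        (Nat.mul_pos r.succ_pos (one_le_of_hasMult hy hy' he)))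
      exact Module.Free.of_equiv ε.symm
    · push Not at hval
      obtain ⟨f, w, hfw⟩ := hval
      have hu : IsUnit (f w) := by
        by_contra hnot
        exact hfw ((mem_maximalIdeal _).mpr hnot)
      obtain ⟨c, hc⟩ := hu.exists_left_inv
      obtain ⟨ε⟩ := exists_equiv_prod_ker (f := f) (w := c • w) (by simpa using hc)
      have : Module.IsTorsionFree R (LinearMap.ker f ⊗[R] Module.Dual R (LinearMap.ker f)) :=
        isTorsionFree_tensor_dual_of_retract (M := M) (ε.symm.toLinearMap ∘ₗ LinearMap.inr R R _)
          (LinearMap.snd R R _ ∘ₗ ε.toLinearMap) (by ext; simp)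
      have := ih (LinearMap.ker f) (nonempty_equiv_of_prod ε h)
      exact Module.Free.of_equiv ε.symm

theorem IsUlrich.le_spanFinrank [Ring.KrullDimLE 1 R] [Module.IsTorsionFree R M] [Nontrivial M]
    (hU : IsUlrich R M) (hdim : ringKrullDim R = 1) {y : R}
    (hy : y ∈ maximalIdeal R) (hy' : y ∈ nonZeroDivisors R) {e : ℕ}
    (he : HasMult M (maximalIdeal R) e) : e ≤ (⊤ : Submodule R M).spanFinrank := by
  have := hU.multiplicity_le
  rw [he.multiplicity_eq (dim_eq_one hdim hy hy'), length_quotient_maximalIdeal, one_mul,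
    ENat.toNat_natCast] at this
  exact_mod_cast this

end Main

end UlrichModule

theorem mainTheorem6 {R : Type u} [CommRing R] [IsLocalRing R] [IsNoetherianRing R]
    (hCM : UlrichModule.IsCohenMacaulay R R) (hdim : ringKrullDim R = 1)
    {M : Type v} [AddCommGroup M] [Module R M] [Module.Finite R M]
    (hM : Module.IsTorsionFree R M)
    (hMM : Module.IsTorsionFree R (M ⊗[R] Module.Dual R M)) :
    (UlrichModule.HasRank R M →
      ((UlrichModule.HasMinimalMultiplicity R ∨ UlrichModule.IsUlrich R M) → Module.Free R M) ∧
      (UlrichModule.IsUlrich R M → Nontrivial M → IsRegularLocalRing R)) ∧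
    (IsDomain R → UlrichModule.IsUlrich R M →
      Module.Free R M ∧ (Nontrivial M → IsRegularLocalRing R)) := by
  open UlrichModule IsLocalRing in
  have hK : Ring.KrullDimLE 1 R := by
    rw [Ring.KrullDimLE, Order.krullDimLE_iff]
    exact hdim.le
  obtain ⟨y, hy, hy'⟩ := exists_mem_nonZeroDivisors_of_isCohenMacaulay hCM hdim
  obtain ⟨e, he, -, -⟩ := exists_hasMult R hy hy'
  have ulrich : ∀ r, IsQuasiFree R M r → IsUlrich R M →
      Module.Free R M ∧ (Nontrivial M → IsRegularLocalRing R) := by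
    intro r hq hU
    rcases subsingleton_or_nontrivial M with hs | hn
    · exact ⟨inferInstance, fun h => absurd hs (not_subsingleton M)⟩
    have hle := hU.le_spanFinrank hdim hy hy' (hq.hasMult he)
    have hr : 0 < r := by
      rw [Nat.pos_iff_ne_zero]
      rintro rfl
      exact not_subsingleton M (subsingleton_of_isQuasiFree_zero hq)
    have hfree := hq.free_of_le_spanFinrank hy hy' he hr hle
    exact ⟨hfree, fun _ => isRegularLocalRing_of_free hy hy' he hq hle hdim⟩
  refine ⟨fun ⟨r, hr⟩ => ⟨?_, fun hU => (ulrich r hr.isQuasiFree hU).2⟩, fun hD hU => ?_⟩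
  · rintro (hmin | hU)
    · refine free_of_minimal_multiplicity hy hy' he ?_ r M hr.nonempty_equiv
      have hd : dim R R = 1 := dim_eq_one hdim hy hy'
      -- In dimension one the terms - dim R + 1 cancel, leaving μ(m) = e.
      rw [HasMinimalMultiplicity, he.multiplicity_eq hd, hd, Nat.cast_one, sub_add_cancel] at hmin
      exact_mod_cast hmin.symm
    · exact (ulrich r hr.isQuasiFree hU).1
  · obtain ⟨r, hq⟩ := exists_isQuasiFree_of_isDomain (R := R) (M := M)
    exact ulrich r hq hU
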